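/- Let $N\ge 2$ be an integer. A discrete Sturm–Liouville problem consists of an equation $$-\nabla(f_n\Delta y_n)+q_ny_n=\lambda w_ny_n,\qquad 1\le n\le N,$$ where $\Delta y_n=y_{n+1}-y_n$ and $\nabla y_n=y_n-y_{n-1}$, and a boundary condition $$A\begin{pmatrix}y_0\\ f_0\Delta y_0\end{pmatrix}+B\begin{pmatrix}y_N\\ f_N\Delta y_N\end{pmatrix}=0,$$ with $A,B\in\mathbb C^{2\times 2}$ and $\operatorname{rank}(A,B)=2$. Let $\Omega_N^{\mathbb C}$ be the set of all $\boldsymbol\omega=(1/f,q,w)\in\mathbb C^{3N+1}$ with $f=(f_n)_{n=0}^N$, $q=(q_n)_{n=1}^N$, $w=(w_n)_{n=1}^N$, all $f_n\ne0$ and all $w_n\neq 0$, with the topology induced from $\mathbb C^{3N+1}$; let $\Omega_N^{\mathbb R,+}\subset\Omega_N^{\mathbb C}$ be the subspace where all entries are real and all $w_n>0$. Let $\mathcal A^{\mathbb C}$ be the space of boundary conditions, that is, the set of $2\times4$ complex matrices $(A,B)$ of rank $2$ modulo $(A,B)\sim(TA,TB)$, $T\in GL(2,\mathbb C)$, with the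 quotient topology; let $\mathcal B^{\mathbb C}\subset\mathcal A^{\mathbb C}$ be the subspace of self-adjoint boundary conditions, i.e. those with $AEA^*=BEB^*$, $E=\begin{pmatrix}0&1\\-1&0\end{pmatrix}$. A problem $(\boldsymbol\omega,\mathbf A)$ is self-adjoint if it lies in $\Omega_N^{\mathbb R,+}\times\mathcal B^{\mathbb C}$. A number $\lambda\in\mathbb C$ is an eigenvalue of $(\boldsymbol\omega,\mathbf A)$ if the problem has a solution $y=(y_n)_{n=0}^{N+1}\ne0$. Its multiplicity is its order as a zero of the polynomial $\Gamma(\lambda)=\det(A+B\Phi_N(\lambda))$, where $$\Phi_N(\lambda)=\begin{pmatrix}\phi_N(\lambda)&\psi_N(\lambda)\\ f_N\Delta\phi_N(\lambda)&f_N\Delta\psi_N(\lambda)\end{pmatrix}$$ and $\phi(\lambda),\psi(\lambda)$ are the solutions of the equation with $\phi_0=1$, $f_0\Delta\phi_0=0$, $\psi_0=0$, $f_0\Delta\psi_0=1$ (the order does not depend on the representative $(A,B)$ of $\mathbf A$). An eigenvalue is simple if its multiplicity is $1$. (1) Let $\lambda_*$ be a simple eigenvalue of $(\boldsymbol\omega,\mathbf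 A)\in\Omega_N^{\mathbb C}\times\mathcal A^{\mathbb C}$. Then there are a connected open neighborhood $\mathcal M$ of $(\boldsymbol\omega,\mathbf A)$ in $\Omega_N^{\mathbb C}\times\mathcal A^{\mathbb C}$ and a continuous function $\Lambda:\mathcal M\to\mathbb C$ such that (i) $\Lambda(\boldsymbol\omega,\mathbf A)=\lambda_*$; (ii) for every $(\boldsymbol\sigma,\mathbf B)\in\mathcal M$, $\Lambda(\boldsymbol\sigma,\mathbf B)$ is a simple eigenvalue of $(\boldsymbol\sigma,\mathbf B)$. (2) Let $\lambda_*$ be an eigenvalue of multiplicity $2$ of a self-adjoint problem $(\boldsymbol\omega,\mathbf A)$. Then $\lambda_*$ is real, and for every $\epsilon>0$ such that $\lambda_*$ is the only eigenvalue of $(\boldsymbol\omega,\mathbf A)$ in $[\lambda_*-\epsilon,\lambda_*+\epsilon]$ there are a connected open neighborhood $\mathcal F$ of $(\boldsymbol\omega,\mathbf A)$ in $\Omega_N^{\mathbb R,+}\times\mathcal B^{\mathbb C}$ and continuous functions $\Lambda_1,\Lambda_2:\mathcal F\to\mathbb R$ such that (i) $\Lambda_1(\boldsymbol\omega,\mathbf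 A)=\Lambda_2(\boldsymbol\omega,\mathbf A)=\lambda_*$; (ii) $\lambda_*-\epsilon<\Lambda_1(\boldsymbol\sigma,\mathbf B)\le\Lambda_2(\boldsymbol\sigma,\mathbf B)<\lambda_*+\epsilon$ for every $(\boldsymbol\sigma,\mathbf B)\in\mathcal F$; (iii) for every $(\boldsymbol\sigma,\mathbf B)\in\mathcal F$, $\Lambda_1(\boldsymbol\sigma,\mathbf B)$ and $\Lambda_2(\boldsymbol\sigma,\mathbf B)$ are eigenvalues of $(\boldsymbol\sigma,\mathbf B)$. -/

import Mathlib

noncomputable section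

open Polynomial Matrix

namespace DiscreteSL

/-! ## Discrete Sturm-Liouville equations -/

/-- The space of equations `(1/f, q, w)`: `f` is indexed by `0, …, N`, while `q` and `w` are indexed
by `1, …, N` (the index `i : Fin N` stands for `n = i + 1`). The first component stores `1/f`.
The topology is the one induced from `ℂ^(3N+1)`. -/
abbrev SLE (N : ℕ) : Type :=
  {p : (Fin (N + 1) → ℂ) × (Fin N → ℂ) × (Fin N → ℂ) //
    (∀ n, p.1 n ≠ 0) ∧ (∀ i, p.2.2 i ≠ 0)}

namespace SLE

variable {N : ℕ}

/-- `1 / f_n` for `n = 0, …, N`. -/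
def invf (ω : SLE N) (n : Fin (N + 1)) : ℂ := ω.1.1 n

/-- `f_n` for `n = 0, …, N`. -/
def f (ω : SLE N) (n : Fin (N + 1)) : ℂ := (ω.invf n)⁻¹

/-- `q_(i+1)` for `i = 0, …, N - 1`. -/
def q (ω : SLE N) (i : Fin N) : ℂ := ω.1.2.1 i

/-- `w_(i+1)` for `i = 0, …, N - 1`. -/
def w (ω : SLE N) (i : Fin N) : ℂ := ω.1.2.2 i

/-- The equations with real coefficients and positive weights. -/
def realPos (N : ℕ) : Set (SLE N) :=
  {ω | (∀ n, (ω.invf n).im = 0) ∧ (∀ i, (ω.q i).im = 0) ∧ (∀ i, (ω.w i).im = 0 ∧ 0 < (ω.w i).re)}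

/-- The quasi-difference `f_n Δy_n`, `n = 0, …, N`, of `y = (y_0, …, y_(N+1))`. -/
def quasiDiff (ω : SLE N) (y : Fin (N + 2) → ℂ) (n : Fin (N + 1)) : ℂ :=
  ω.f n * (y n.succ - y n.castSucc)

/-- `y` solves `-∇(f_n Δy_n) + q_n y_n = lam w_n y_n` for `n = 1, …, N`. -/
def IsSolution (ω : SLE N) (lam : ℂ) (y : Fin (N + 2) → ℂ) : Prop :=
  ∀ i : Fin N,
    -(ω.quasiDiff y i.succ - ω.quasiDiff y i.castSucc) + ω.q i * y i.succ.castSucc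
      = lam * ω.w i * y i.succ.castSucc

/-- The pairs `(y_n, f_n Δy_n)`, `n = 0, …, N`, as polynomials in the spectral parameter, of the
solution `y` with `y_0 = a` and `f_0 Δy_0 = b`. -/
def solPoly (ω : SLE N) (a b : ℂ) : Fin (N + 1) → ℂ[X] × ℂ[X] :=
  Fin.induction (C a, C b) fun i s =>
    (s.1 + C (ω.invf i.castSucc) * s.2,
      s.2 + (C (ω.q i) - C (ω.w i) * X) * (s.1 + C (ω.invf i.castSucc) * s.2))

/-- `solPoly` is the solution of the initial value problem. -/
theorem isSolution_and_init_iff (ω : SLE N) (a b lam : ℂ) (y : Fin (N + 2) → ℂ) :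
    (ω.IsSolution lam y ∧ y 0 = a ∧ ω.quasiDiff y 0 = b) ↔
      ∀ n : Fin (N + 1), y n.castSucc = (ω.solPoly a b n).1.eval lam ∧
        ω.quasiDiff y n = (ω.solPoly a b n).2.eval lam := by
  have step : ∀ i : Fin N, y i.succ.castSucc
      = y i.castSucc.castSucc + ω.invf i.castSucc * ω.quasiDiff y i.castSucc := by
    intro i
    have h : ω.invf i.castSucc ≠ 0 := ω.2.1 i.castSucc
    simp only [quasiDiff, f, Fin.succ_castSucc]
    field_simp
    ring
  constructor
  · rintro ⟨hs, h0, h1⟩ n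
    induction n using Fin.induction with
    | zero => simpa [solPoly] using ⟨h0, h1⟩
    | succ i ih =>
      obtain ⟨ih1, ih2⟩ := ih
      have e := hs i
      have hst := step i
      have hy : y i.succ.castSucc = (ω.solPoly a b i.succ).1.eval lam := by
        rw [hst, ih1, ih2]
        simp [solPoly]
      refine ⟨hy, ?_⟩
      have h2 : ω.quasiDiff y i.succ
          = ω.quasiDiff y i.castSucc + (ω.q i - lam * ω.w i) * y i.succ.castSucc := by
        linear_combination -e
      rw [h2, hst, ih1, ih2]
      simp only [solPoly, Fin.induction_succ, eval_add, eval_sub, eval_mul, eval_C, eval_X]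
      ring
  · intro h
    refine ⟨fun i => ?_, ?_, ?_⟩
    · have hst := step i
      have h1 := h i.castSucc
      have h2 := (h i.succ).2
      have h3 : ω.quasiDiff y i.succ
          = ω.quasiDiff y i.castSucc + (ω.q i - lam * ω.w i) * y i.succ.castSucc := by
        rw [h2, hst, h1.1, h1.2]
        simp only [solPoly, Fin.induction_succ, eval_add, eval_sub, eval_mul, eval_C, eval_X]
        ring
      linear_combination -h3
    · simpa [solPoly] using (h 0).1
    · simpa [solPoly] using (h 0).2

/-- The transfer matrix `Φ_N`, with columns `(φ_N, f_N Δφ_N)` and `(ψ_N, f_N Δψ_N)`, where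
`φ_0 = 1`, `f_0 Δφ_0 = 0`, `ψ_0 = 0`, `f_0 Δψ_0 = 1`. -/
def transfer (ω : SLE N) : Matrix (Fin 2) (Fin 2) ℂ[X] :=
  !![(ω.solPoly 1 0 (Fin.last N)).1, (ω.solPoly 0 1 (Fin.last N)).1;
     (ω.solPoly 1 0 (Fin.last N)).2, (ω.solPoly 0 1 (Fin.last N)).2]

end SLE

/-! ## Boundary conditions -/

/-- The `2 × 4` complex matrices `(A, B)` of rank `2`. -/
abbrev BCMatrix : Type :=
  {P : Matrix (Fin 2) (Fin 2) ℂ × Matrix (Fin 2) (Fin 2) ℂ // (Matrix.fromCols P.1 P.2).rank = 2}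

/-- `(A, B)` and `(A₁, B₁)` are equivalent if `(A₁, B₁) = (T A, T B)` for some `T` in `GL(2, ℂ)`. -/
instance bcSetoid : Setoid BCMatrix where
  r P Q := ∃ T : GL (Fin 2) ℂ,
    Q.1.1 = (T : Matrix (Fin 2) (Fin 2) ℂ) * P.1.1 ∧ Q.1.2 = (T : Matrix (Fin 2) (Fin 2) ℂ) * P.1.2
  iseqv :=
    { refl := fun P => ⟨1, by simp, by simp⟩
      symm := by
        rintro P Q ⟨T, h1, h2⟩
        exact ⟨T⁻¹, by rw [h1, ← Matrix.mul_assoc, ← Units.val_mul]; simp,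
          by rw [h2, ← Matrix.mul_assoc, ← Units.val_mul]; simp⟩
      trans := by
        rintro P Q R ⟨T, h1, h2⟩ ⟨S, h3, h4⟩
        exact ⟨S * T, by rw [h3, h1, Units.val_mul, Matrix.mul_assoc],
          by rw [h4, h2, Units.val_mul, Matrix.mul_assoc]⟩ }

/-- The space of boundary conditions `[A | B]`, with the quotient topology. -/
abbrev BC : Type := Quotient bcSetoid

/-- The vectors `Y₀ = (y_0, f_0 Δy_0)` and `Y₁ = (y_N, f_N Δy_N)` satisfy `A Y₀ + B Y₁ = 0`. -/
def BC.Holds (bc : BC) (Y₀ Y₁ : Fin 2 → ℂ) : Prop :=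
  Quotient.liftOn bc (fun P => P.1.1 *ᵥ Y₀ + P.1.2 *ᵥ Y₁ = 0) (by
    rintro P Q ⟨T, h1, h2⟩
    simp only [h1, h2, ← Matrix.mulVec_mulVec, ← Matrix.mulVec_add, eq_iff_iff]
    constructor
    · intro h
      rw [h, Matrix.mulVec_zero]
    · intro h
      have h' := congrArg (fun v => ((T⁻¹ : GL (Fin 2) ℂ) : Matrix (Fin 2) (Fin 2) ℂ) *ᵥ v) h
      simpa only [Matrix.mulVec_mulVec, ← Units.val_mul, inv_mul_cancel, Units.val_one,
        Matrix.one_mulVec, Matrix.mulVec_zero] using h')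

/-- The matrix `E`. -/
def symplE : Matrix (Fin 2) (Fin 2) ℂ := !![0, 1; -1, 0]

/-- The boundary condition `[A | B]` is self-adjoint: `A E A* = B E B*`. -/
def BC.IsSelfAdjoint (bc : BC) : Prop :=
  Quotient.liftOn bc (fun P => P.1.1 * symplE * P.1.1ᴴ = P.1.2 * symplE * P.1.2ᴴ) (by
    rintro P Q ⟨T, h1, h2⟩
    have key : ∀ M : Matrix (Fin 2) (Fin 2) ℂ,
        ((T : Matrix (Fin 2) (Fin 2) ℂ) * M) * symplE * ((T : Matrix (Fin 2) (Fin 2) ℂ) * M)ᴴ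
          = (T : Matrix (Fin 2) (Fin 2) ℂ) * (M * symplE * Mᴴ)
            * (T : Matrix (Fin 2) (Fin 2) ℂ)ᴴ := by
      intro M
      simp only [Matrix.conjTranspose_mul, Matrix.mul_assoc]
    have hT : IsUnit (T : Matrix (Fin 2) (Fin 2) ℂ) := T.isUnit
    have hT' : IsUnit (T : Matrix (Fin 2) (Fin 2) ℂ)ᴴ := hT.star
    simp only [h1, h2, key, eq_iff_iff]
    rw [hT'.mul_left_inj, hT.mul_right_inj])

/-- The space of self-adjoint boundary conditions. -/
def selfAdjointBC : Set BC := {bc | bc.IsSelfAdjoint}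

/-! ## Eigenvalues and their multiplicities -/

variable {N : ℕ}

/-- `lam` is an eigenvalue of `(ω, bc)`: the problem has a non-trivial solution. -/
def IsEigenvalue (ω : SLE N) (bc : BC) (lam : ℂ) : Prop :=
  ∃ y : Fin (N + 2) → ℂ, y ≠ 0 ∧ ω.IsSolution lam y ∧
    bc.Holds ![y (0 : Fin (N + 1)).castSucc, ω.quasiDiff y 0]
      ![y (Fin.last N).castSucc, ω.quasiDiff y (Fin.last N)]

/-- The characteristic function `det (A + B Φ_N)`, a polynomial in the spectral parameter. -/
def charPoly (ω : SLE N) (P : BCMatrix) : ℂ[X] :=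
  (P.1.1.map C + P.1.2.map C * ω.transfer).det

/-- The (analytic) multiplicity of `lam`: its order as a zero of the characteristic function,
which does not depend on the matrices representing the boundary condition. -/
def analyticMult (ω : SLE N) (bc : BC) (lam : ℂ) : ℕ :=
  Quotient.liftOn bc (fun P => (charPoly ω P).rootMultiplicity lam) (by
    rintro P Q ⟨T, h1, h2⟩
    have hdet : (T : Matrix (Fin 2) (Fin 2) ℂ).det ≠ 0 :=
      ((Matrix.isUnit_iff_isUnit_det _).1 T.isUnit).ne_zero
    have hQ : charPoly ω Q = C (T : Matrix (Fin 2) (Fin 2) ℂ).det * charPoly ω P := by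
      have hC : C (T : Matrix (Fin 2) (Fin 2) ℂ).det
          = ((T : Matrix (Fin 2) (Fin 2) ℂ).map C).det := RingHom.map_det C _
      rw [charPoly, charPoly, h1, h2, hC, ← Matrix.det_mul, Matrix.map_mul, Matrix.map_mul,
        Matrix.mul_add, Matrix.mul_assoc]
    by_cases hP : charPoly ω P = 0
    · simp only [hQ, hP, mul_zero]
    · simp only [hQ]
      rw [Polynomial.rootMultiplicity_mul (mul_ne_zero (C_ne_zero.2 hdet) hP),
        Polynomial.rootMultiplicity_C, zero_add])

/-- `lam` is an eigenvalue of `(ω, bc)` of multiplicity `m`. -/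
def IsEigenvalueOfMult (ω : SLE N) (bc : BC) (lam : ℂ) (m : ℕ) : Prop :=
  IsEigenvalue ω bc lam ∧ analyticMult ω bc lam = m

end DiscreteSL

end

open DiscreteSL

/-! Eigenvalues are the roots of Γ (`isEigenvalue_mk_iff`), a polynomial of bounded degree whose
coefficients vary continuously with the equation and with the matrices (A, B). Roots persist in such
a family by an elementary estimate, `norm_eval_le_of_forall_isRoot`: a polynomial without roots near
z₀ cannot be small at z₀ and much larger close by. Dividing out the linear factor of a persistent
root leaves a quotient that again converges (`exists_factor`), so the argument can be repeated: one
division gives Λ, two give the pair Λ₁, Λ₂.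

The last quotient does not vanish on a compact set around λ_*, and this open condition makes the
roots there unique. They therefore depend only on the class of (A, B), and continuity descends along
the open quotient map. In (2) the roots are real by the Lagrange identity
(`im_eq_zero_of_isEigenvalue`), so the two of them can be sorted by min and max.

Connected neighborhoods come from local path connectedness. The one case that needs work is the
space of self-adjoint boundary conditions, which is charted by Hermitian 2 × 2 matrices. -/

open Polynomial Matrix Filter Topology
open DiscreteSL

/-! ### Persistence of roots under perturbation of the coefficients. -/

section RootPerturbation

/-- The polynomials `P t` have degree at most `d` and converge to `p` coefficientwise along `l`. -/
def TendstoCoeff {T : Type*} (l : Filter T) (P : T → ℂ[X]) (p : ℂ[X]) (d : ℕ) : Prop :=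
  p.natDegree ≤ d ∧ (∀ t, (P t).natDegree ≤ d) ∧
    ∀ i, Tendsto (fun t => (P t).coeff i) l (𝓝 (p.coeff i))

/-- Each root z gives |y - z| ≤ |y - x| + |x - z| ≤ 2|x - z|; multiply over the roots. -/
theorem norm_eval_le_of_forall_isRoot {q : ℂ[X]} {x y : ℂ} {δ : ℝ}
    (hq : ∀ z, q.IsRoot z → δ ≤ ‖x - z‖) (hy : ‖y - x‖ ≤ δ) :
    ‖q.eval y‖ ≤ 2 ^ q.natDegree * ‖q.eval x‖ := by
  by_cases h0 : q = 0
  · simp [h0]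
  have hs : q.Splits := IsAlgClosed.splits q
  have key : ∀ s : Multiset ℂ, (∀ z ∈ s, δ ≤ ‖x - z‖) →
      ‖(s.map (y - ·)).prod‖ ≤ 2 ^ Multiset.card s * ‖(s.map (x - ·)).prod‖ := by
    intro s
    induction s using Multiset.induction with
    | empty => intro _; simp
    | cons a s ih =>
      intro h
      have h1 := ih fun z hz => h z (Multiset.mem_cons_of_mem hz)
      have h2 := h a (Multiset.mem_cons_self a s)
      have h3 : ‖y - a‖ ≤ 2 * ‖x - a‖ := by
        calc ‖y - a‖ = ‖(y - x) + (x - a)‖ := by ring_nf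
          _ ≤ ‖y - x‖ + ‖x - a‖ := norm_add_le _ _
          _ ≤ 2 * ‖x - a‖ := by linarith
      simp only [Multiset.map_cons, Multiset.prod_cons, norm_mul, Multiset.card_cons, pow_succ]
      calc ‖y - a‖ * ‖(s.map (y - ·)).prod‖
          ≤ (2 * ‖x - a‖) * (2 ^ Multiset.card s * ‖(s.map (x - ·)).prod‖) := by gcongr
        _ = _ := by ring
  rw [hs.eval_eq_prod_roots, hs.eval_eq_prod_roots, norm_mul, norm_mul, hs.natDegree_eq_card_roots]
  have := key q.roots fun z hz => hq z (isRoot_of_mem_roots hz)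
  calc ‖q.leadingCoeff‖ * ‖(q.roots.map (y - ·)).prod‖
      ≤ ‖q.leadingCoeff‖ * (2 ^ Multiset.card q.roots * ‖(q.roots.map (x - ·)).prod‖) := by gcongr
    _ = _ := by ring

namespace TendstoCoeff

variable {T : Type*} {l : Filter T} {P : T → ℂ[X]} {p : ℂ[X]} {d : ℕ}

theorem comp {S : Type*} {l' : Filter S} {g : S → T} (h : TendstoCoeff l P p d)
    (hg : Tendsto g l' l) : TendstoCoeff l' (P ∘ g) p d :=
  ⟨h.1, fun t => h.2.1 (g t), fun i => (h.2.2 i).comp hg⟩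

theorem eval (h : TendstoCoeff l P p d) {z : T → ℂ} {z₀ : ℂ} (hz : Tendsto z l (𝓝 z₀)) :
    Tendsto (fun t => (P t).eval (z t)) l (𝓝 (p.eval z₀)) := by
  have e : ∀ t, (P t).eval (z t) = ∑ i ∈ Finset.range (d + 1), (P t).coeff i * z t ^ i :=
    fun t => eval_eq_sum_range' (Nat.lt_succ_of_le (h.2.1 t)) _
  simp only [e, eval_eq_sum_range' (Nat.lt_succ_of_le h.1)]
  exact tendsto_finsetSum _ fun i _ => (h.2.2 i).mul (hz.pow i)

/-- Choose y in the δ-ball with p(y) ≠ 0. Since P t at z₀ tends to 0 while P t at y does not, the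
preceding estimate, with the uniform constant 2 ^ d, rules out a root-free ball. The degree of P t
may exceed that of p. -/
theorem eventually_exists_isRoot (h : TendstoCoeff l P p d) (hp : p ≠ 0) {z₀ : ℂ}
    (hz : p.IsRoot z₀) {δ : ℝ} (hδ : 0 < δ) :
    ∀ᶠ t in l, ∃ z, (P t).IsRoot z ∧ ‖z₀ - z‖ < δ := by
  obtain ⟨y, hy, hyp⟩ := (infinite_of_mem_nhds z₀ (Metric.ball_mem_nhds z₀ hδ)).exists_notMem_finite
    (finite_setOfPred_isRoot hp)
  have h1 := (h.eval (tendsto_const_nhds (x := z₀))).norm.const_mul (2 ^ d)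
  have h2 := (h.eval (tendsto_const_nhds (x := y))).norm
  rw [hz.eq_zero, norm_zero, mul_zero] at h1
  have h3 : 0 < ‖p.eval y‖ := norm_pos_iff.2 hyp
  filter_upwards [h1.eventually_lt h2 h3] with t ht
  by_contra! hc
  have h4 := norm_eval_le_of_forall_isRoot hc (mem_ball_iff_norm.1 hy).le
  have h5 : (2 : ℝ) ^ (P t).natDegree ≤ 2 ^ d := pow_le_pow_right₀ one_le_two (h.2.1 t)
  have h6 := mul_le_mul_of_nonneg_right h5 (norm_nonneg ((P t).eval z₀))
  linarith

theorem exists_tendsto_isRoot (h : TendstoCoeff l P p d) (hp : p ≠ 0) {z₀ : ℂ}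
    (hz : p.IsRoot z₀) :
    ∃ r : T → ℂ, Tendsto r l (𝓝 z₀) ∧ ∀ᶠ t in l, (P t).IsRoot (r t) := by
  -- `r t` is a root nearest to z₀; the value is arbitrary when there is no root.
  have key : ∀ t, ∃ r, ∀ z, (P t).IsRoot z → (P t).IsRoot r ∧ ‖z₀ - r‖ ≤ ‖z₀ - z‖ := by
    intro t
    by_cases hne : {z | (P t).IsRoot z}.Nonempty
    · have hcl : IsClosed {z | (P t).IsRoot z} := isClosed_eq (P t).continuous continuous_const
      obtain ⟨r, hr, hrd⟩ := hcl.exists_infDist_eq_dist hne z₀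
      refine ⟨r, fun z hz => ⟨hr, ?_⟩⟩
      rw [← dist_eq_norm, ← dist_eq_norm, ← hrd]
      exact Metric.infDist_le_dist_of_mem hz
    · exact ⟨0, fun z hz => (hne ⟨z, hz⟩).elim⟩
  choose r hr using key
  refine ⟨r, ?_, ?_⟩
  · rw [Metric.tendsto_nhds]
    intro δ hδ
    filter_upwards [h.eventually_exists_isRoot hp hz hδ] with t ⟨z, hz1, hz2⟩
    rw [dist_comm, dist_eq_norm]
    exact ((hr t z hz1).2).trans_lt hz2
  · filter_upwards [h.eventually_exists_isRoot hp hz one_pos] with t ⟨z, hz1, _⟩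
    exact (hr t z hz1).1

theorem exists_factor (h : TendstoCoeff l P p d) {z₀ : ℂ} {q : ℂ[X]} (hq : q ≠ 0)
    (hpq : p = (X - C z₀) * q) :
    ∃ (r : T → ℂ) (Q : T → ℂ[X]), Tendsto r l (𝓝 z₀) ∧ TendstoCoeff l Q q d ∧
      ∀ᶠ t in l, P t = (X - C (r t)) * Q t := by
  have hp : p ≠ 0 := hpq ▸ mul_ne_zero (X_sub_C_ne_zero z₀) hq
  have hroot : p.IsRoot z₀ := by simp [hpq]
  obtain ⟨r, hr, hrP⟩ := h.exists_tendsto_isRoot hp hroot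
  -- Summing up to the fixed bound d instead of the degree makes the index set independent of t, so
  -- each coefficient of the quotient converges as a finite sum.
  have hcoeff : ∀ (s : ℂ[X]) (a : ℂ) (n : ℕ), s.natDegree ≤ d →
      (s /ₘ (X - C a)).coeff n = ∑ i ∈ Finset.Icc (n + 1) d, a ^ (i - (n + 1)) * s.coeff i := by
    intro s a n hs
    rw [coeff_divByMonic_X_sub_C]
    refine Finset.sum_subset (Finset.Icc_subset_Icc_right hs) fun i hi hi' => ?_
    rw [Finset.mem_Icc] at hi hi'
    rw [coeff_eq_zero_of_natDegree_lt (by omega), mul_zero]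
  have hq' : q = p /ₘ (X - C z₀) := by
    rw [hpq, mul_divByMonic_cancel_left _ (monic_X_sub_C z₀)]
  have hdeg : ∀ (s : ℂ[X]) (a : ℂ), (s /ₘ (X - C a)).natDegree ≤ s.natDegree := fun s a => by
    rw [natDegree_divByMonic _ (monic_X_sub_C a)]
    exact Nat.sub_le _ _
  refine ⟨r, fun t => P t /ₘ (X - C (r t)), hr, ⟨?_, fun t => (hdeg _ _).trans (h.2.1 t), ?_⟩, ?_⟩
  · rw [hq']
    exact (hdeg _ _).trans h.1
  · intro n
    rw [hq']
    simp only [hcoeff _ _ n (h.2.1 _), hcoeff _ _ n h.1]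
    exact tendsto_finsetSum _ fun i _ => (hr.pow _).mul (h.2.2 i)
  · filter_upwards [hrP] with t ht
    exact (mul_divByMonic_eq_iff_isRoot.2 ht).symm

theorem eventually_forall_eval_ne_zero (h : TendstoCoeff l P p d) {K : Set ℂ} (hK : IsCompact K)
    (hp : ∀ z ∈ K, p.eval z ≠ 0) : ∀ᶠ t in l, ∀ z ∈ K, (P t).eval z ≠ 0 := by
  refine hK.induction_on (p := fun K => ∀ᶠ t in l, ∀ z ∈ K, (P t).eval z ≠ 0) (by simp)
    (fun s t hst ht => ht.mono fun x hx z hz => hx z (hst hz))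
    (fun s t hs ht => ?_) (fun z hz => ?_)
  · filter_upwards [hs, ht] with x h1 h2 z hz
    exact hz.elim (h1 z) (h2 z)
  · have h1 := ((h.comp (tendsto_fst (g := 𝓝 z))).eval tendsto_snd).eventually_ne (hp z hz)
    obtain ⟨pa, ha, pb, hb, hab⟩ := eventually_prod_iff.1 h1
    exact ⟨{z | pb z}, mem_nhdsWithin_of_mem_nhds hb, ha.mono fun t ht z hz => hab ht hz⟩

end TendstoCoeff

end RootPerturbation

/-! ### Continuous root branches over an open quotient. -/

section RootBranches

variable {T Y : Type*} [TopologicalSpace T] [TopologicalSpace Y]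

/-- The polynomials `G t` have degree at most `d` and coefficients depending continuously on `t`. -/
def ContinuousCoeff (G : T → ℂ[X]) (d : ℕ) : Prop :=
  (∀ t, (G t).natDegree ≤ d) ∧ ∀ i, Continuous fun t => (G t).coeff i

theorem ContinuousCoeff.tendstoCoeff {G : T → ℂ[X]} {d : ℕ} (h : ContinuousCoeff G d) (t : T) :
    TendstoCoeff (𝓝 t) G (G t) d :=
  ⟨h.1 t, h.1, fun i => (h.2 i).tendsto t⟩

theorem exists_isConnected_isOpen_subset [LocallyConnectedSpace Y] {x : Y} {S : Set Y}
    (hS : S ∈ 𝓝 x) : ∃ M : Set Y, IsOpen M ∧ IsConnected M ∧ x ∈ M ∧ M ⊆ S := by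
  obtain ⟨M, ⟨h1, h2, h3⟩, h4⟩ := (LocallyConnectedSpace.open_connected_basis x).mem_iff.1 hS
  exact ⟨M, h1, h3, h2, h4⟩

variable [LocallyConnectedSpace Y] {π : T → Y} {G : T → ℂ[X]} {d : ℕ}

/-- Here π sends representatives to problems, and G t is determined by π t only as far as its roots
are concerned. The branch is built upstairs and descends because it is the only root in a fixed
closed ball. -/
theorem exists_simple_root_branch (hπ : IsOpenQuotientMap π) (hG : ContinuousCoeff G d)
    (hcompat : ∀ t t', π t = π t' → ∀ z, (G t).IsRoot z → (G t').IsRoot z)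
    (t₀ : T) (lam : ℂ) (hlam : (G t₀).rootMultiplicity lam = 1) :
    ∃ (M : Set Y) (Λ : Y → ℂ), IsOpen M ∧ IsConnected M ∧ π t₀ ∈ M ∧ ContinuousOn Λ M ∧
      Λ (π t₀) = lam ∧ ∀ x ∈ M, ∃ t, π t = x ∧ (G t).rootMultiplicity (Λ x) = 1 := by
  classical
  have hG0 : G t₀ ≠ 0 := by
    intro h
    simp [h] at hlam
  obtain ⟨q₀, hq₀, hq₀'⟩ := exists_eq_pow_rootMultiplicity_mul_and_not_dvd (G t₀) hG0 lam
  rw [hlam, pow_one] at hq₀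
  rw [dvd_iff_isRoot] at hq₀'
  obtain ⟨ε, hε, hεq⟩ := Metric.nhds_basis_closedBall.eventually_iff.1
    (q₀.continuous.continuousAt.eventually_ne hq₀')
  -- The open ball makes the condition on a stable under perturbation; compactness of the closed
  -- ball does the same for the nonvanishing of q.
  set GoodAt : T → ℂ → Prop := fun t a => a ∈ Metric.ball lam ε ∧
    ∃ q : ℂ[X], G t = (X - C a) * q ∧ ∀ z ∈ Metric.closedBall lam ε, q.eval z ≠ 0
  have good₀ : GoodAt t₀ lam := ⟨Metric.mem_ball_self hε, q₀, hq₀, fun z hz => hεq hz⟩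
  have isRoot_of_good : ∀ {t a}, GoodAt t a → (G t).IsRoot a := by
    rintro t a ⟨_, q, hq, _⟩
    simp [hq]
  have unique : ∀ {t a}, GoodAt t a → ∀ z ∈ Metric.closedBall lam ε, (G t).IsRoot z → z = a := by
    rintro t a ⟨_, q, hq, hqz⟩ z hz hr
    rw [hq, IsRoot, eval_mul, mul_eq_zero, or_iff_left (hqz z hz)] at hr
    simpa [sub_eq_zero] using hr
  have key : ∀ {t a}, GoodAt t a → ∃ r : T → ℂ, Tendsto r (𝓝 t) (𝓝 a) ∧
      ∀ᶠ t' in 𝓝 t, GoodAt t' (r t') := by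
    rintro t a ⟨ha, q, hq, hqz⟩
    have hq0 : q ≠ 0 := by
      rintro rfl
      exact hqz a (Metric.ball_subset_closedBall ha) eval_zero
    obtain ⟨r, Q, hr, hQ, hrQ⟩ := (hG.tendstoCoeff t).exists_factor hq0 hq
    refine ⟨r, hr, ?_⟩
    filter_upwards [hrQ, hQ.eventually_forall_eval_ne_zero (isCompact_closedBall lam ε) hqz,
      hr.eventually_mem (Metric.isOpen_ball.mem_nhds ha)] with t' h1 h2 h3
    exact ⟨h3, Q t', h1, h2⟩
  -- The value 0 is never used: M lies in the set where a good root exists.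
  set Λ : Y → ℂ := fun x => if h : ∃ a, ∃ t, π t = x ∧ GoodAt t a then h.choose else 0 with hΛdef
  have hΛ : ∀ {t a}, GoodAt t a → Λ (π t) = a := by
    intro t a h
    have hex : ∃ a', ∃ t', π t' = π t ∧ GoodAt t' a' := ⟨a, t, rfl, h⟩
    obtain ⟨t', ht', hg⟩ := hex.choose_spec
    simp only [hΛdef, dif_pos hex]
    exact unique h _ (Metric.ball_subset_closedBall hg.1) (hcompat _ _ ht' _ (isRoot_of_good hg))
  have hS : {x | ∃ t a, π t = x ∧ GoodAt t a} ∈ 𝓝 (π t₀) := by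
    obtain ⟨r, _, hr⟩ := key good₀
    rw [← hπ.map_nhds_eq]
    exact hr.mono fun t ht => ⟨t, r t, rfl, ht⟩
  obtain ⟨M, hM1, hM2, hM3, hM4⟩ := exists_isConnected_isOpen_subset hS
  refine ⟨M, Λ, hM1, hM2, hM3, fun x hx => ContinuousAt.continuousWithinAt ?_, hΛ good₀, ?_⟩
  · obtain ⟨t, a, rfl, h⟩ := hM4 hx
    obtain ⟨r, hr, hr'⟩ := key h
    rw [ContinuousAt, hΛ h, ← hπ.map_nhds_eq, tendsto_map'_iff]
    exact hr.congr' (hr'.mono fun t' ht' => (hΛ ht').symm)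
  · intro x hx
    obtain ⟨t, a, rfl, h⟩ := hM4 hx
    refine ⟨t, rfl, ?_⟩
    rw [hΛ h]
    obtain ⟨ha, q, hq, hqz⟩ := h
    have hqa := hqz a (Metric.ball_subset_closedBall ha)
    have hq0 : q ≠ 0 := by
      rintro rfl
      exact hqa eval_zero
    rw [hq, rootMultiplicity_mul (mul_ne_zero (X_sub_C_ne_zero a) hq0),
      rootMultiplicity_X_sub_C_self, rootMultiplicity_eq_zero hqa]

theorem exists_double_root_branches (hπ : IsOpenQuotientMap π) (hG : ContinuousCoeff G d)
    (hcompat : ∀ t t', π t = π t' → ∀ z, (G t).IsRoot z → (G t').IsRoot z)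
    (hreal : ∀ t z, (G t).IsRoot z → z.im = 0)
    (t₀ : T) (l : ℝ) (hl : (G t₀).rootMultiplicity (l : ℂ) = 2) {ε : ℝ} (hε : 0 < ε)
    (hiso : ∀ μ ∈ Set.Icc (l - ε) (l + ε), (G t₀).IsRoot (μ : ℂ) → μ = l) :
    ∃ (F : Set Y) (Λ₁ Λ₂ : Y → ℝ), IsOpen F ∧ IsConnected F ∧ π t₀ ∈ F ∧
      ContinuousOn Λ₁ F ∧ ContinuousOn Λ₂ F ∧ Λ₁ (π t₀) = l ∧ Λ₂ (π t₀) = l ∧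
      (∀ x ∈ F, l - ε < Λ₁ x ∧ Λ₁ x ≤ Λ₂ x ∧ Λ₂ x < l + ε) ∧
      ∀ x ∈ F, ∃ t, π t = x ∧ (G t).IsRoot (Λ₁ x : ℂ) ∧ (G t).IsRoot (Λ₂ x : ℂ) := by
  classical
  have hG0 : G t₀ ≠ 0 := by
    intro h
    simp [h] at hl
  obtain ⟨q₀, hq₀, hq₀'⟩ := exists_eq_pow_rootMultiplicity_mul_and_not_dvd (G t₀) hG0 (l : ℂ)
  rw [hl, pow_two, mul_assoc] at hq₀
  rw [dvd_iff_isRoot] at hq₀'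
  set K : Set ℝ := Set.Icc (l - ε) (l + ε) with hK
  -- All roots are real, so it suffices that q has no zero on the real segment K, which is all that
  -- the isolation hypothesis provides at t₀.
  set GoodAt : T → ℝ → ℝ → Prop := fun t a b => l - ε < a ∧ a ≤ b ∧ b < l + ε ∧
    ∃ q : ℂ[X], G t = (X - C (a : ℂ)) * ((X - C (b : ℂ)) * q) ∧
      ∀ z ∈ K, q.eval (z : ℂ) ≠ 0
  have good₀ : GoodAt t₀ l l := by
    refine ⟨by linarith, le_rfl, by linarith, q₀, hq₀, fun z hz h => hq₀' ?_⟩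
    have : z = l := hiso z hz (by rw [IsRoot, hq₀]; simp [h])
    rwa [this] at h
  have left_of_good : ∀ {t a b}, GoodAt t a b → (G t).IsRoot (a : ℂ) := by
    rintro t a b ⟨_, _, _, q, hq, _⟩
    simp [hq]
  have right_of_good : ∀ {t a b}, GoodAt t a b → (G t).IsRoot (b : ℂ) := by
    rintro t a b ⟨_, _, _, q, hq, _⟩
    simp [hq]
  have unique : ∀ {t a b}, GoodAt t a b → ∀ z ∈ K, (G t).IsRoot (z : ℂ) → z = a ∨ z = b := by
    rintro t a b ⟨_, _, _, q, hq, hqz⟩ z hz hr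
    rw [hq, IsRoot, eval_mul, eval_mul, mul_eq_zero, mul_eq_zero, or_iff_left (hqz z hz)] at hr
    simpa [sub_eq_zero] using hr
  have key : ∀ {t a b}, GoodAt t a b → ∃ r s : T → ℝ, Tendsto r (𝓝 t) (𝓝 a) ∧
      Tendsto s (𝓝 t) (𝓝 b) ∧ ∀ᶠ t' in 𝓝 t, GoodAt t' (r t') (s t') := by
    rintro t a b ⟨ha, hab, hb, q, hq, hqz⟩
    have hq0 : q ≠ 0 := by
      rintro rfl
      exact hqz a ⟨ha.le, by linarith⟩ eval_zero
    obtain ⟨r, R, hr, hR, hrR⟩ :=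
      (hG.tendstoCoeff t).exists_factor (mul_ne_zero (X_sub_C_ne_zero _) hq0) hq
    obtain ⟨s, Q, hs, hQ, hsQ⟩ := hR.exists_factor hq0 rfl
    have hr' : Tendsto (fun t' => (r t').re) (𝓝 t) (𝓝 a) :=
      (Complex.continuous_re.tendsto (a : ℂ)).comp hr
    have hs' : Tendsto (fun t' => (s t').re) (𝓝 t) (𝓝 b) :=
      (Complex.continuous_re.tendsto (b : ℂ)).comp hs
    -- The two extracted roots need not come in order, and may swap as t' varies; min and max
    -- restore the order and remain continuous.
    have hmin := hr'.min hs'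
    have hmax := hr'.max hs'
    rw [min_eq_left hab] at hmin
    rw [max_eq_right hab] at hmax
    refine ⟨_, _, hmin, hmax, ?_⟩
    have hKc : IsCompact ((fun x : ℝ => (x : ℂ)) '' K) :=
      isCompact_Icc.image Complex.continuous_ofReal
    filter_upwards [hrR, hsQ, hQ.eventually_forall_eval_ne_zero hKc (by
      rintro _ ⟨z, hz, rfl⟩
      exact hqz z hz), hmin.eventually_const_lt ha, hmax.eventually_lt_const hb]
      with t' h1 h2 h3 h4 h5
    refine ⟨h4, min_le_max, h5, Q t', ?_, fun z hz => h3 _ ⟨z, hz, rfl⟩⟩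
    rw [h2] at h1
    have e1 : r t' = ((r t').re : ℂ) :=
      Complex.ext rfl (by simpa using hreal t' (r t') (by simp [h1]))
    have e2 : s t' = ((s t').re : ℂ) :=
      Complex.ext rfl (by simpa using hreal t' (s t') (by simp [h1]))
    rw [h1]
    nth_rewrite 1 [e1, e2]
    rcases le_total (r t').re (s t').re with h | h
    · rw [min_eq_left h, max_eq_right h]
    · rw [min_eq_right h, max_eq_left h, ← mul_assoc, ← mul_assoc, mul_comm (X - C _)]
  set Λ : Y → ℝ × ℝ := fun x =>
    if h : ∃ a : ℝ × ℝ, ∃ t, π t = x ∧ GoodAt t a.1 a.2 then h.choose else 0 with hΛdef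
  have hΛ : ∀ {t a b}, GoodAt t a b → Λ (π t) = (a, b) := by
    intro t a b h
    have hex : ∃ a' : ℝ × ℝ, ∃ t', π t' = π t ∧ GoodAt t' a'.1 a'.2 := ⟨(a, b), t, rfl, h⟩
    obtain ⟨t', ht', hg⟩ := hex.choose_spec
    simp only [hΛdef, dif_pos hex]
    generalize hex.choose = c at hg
    have u1 := unique h c.1 ⟨hg.1.le, by linarith [hg.2.1, hg.2.2.1]⟩
      (hcompat _ _ ht' _ (left_of_good hg))
    have u2 := unique h c.2 ⟨by linarith [hg.1, hg.2.1], hg.2.2.1.le⟩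
      (hcompat _ _ ht' _ (right_of_good hg))
    have u3 := unique hg a ⟨h.1.le, by linarith [h.2.1, h.2.2.1]⟩
      (hcompat _ _ ht'.symm _ (left_of_good h))
    have u4 := unique hg b ⟨by linarith [h.1, h.2.1], h.2.2.1.le⟩
      (hcompat _ _ ht'.symm _ (right_of_good h))
    have hab := h.2.1
    have hcc := hg.2.1
    -- Both pairs have the same underlying set and are ordered, hence coincide, also when a = b.
    ext
    · rcases u1 with u1 | u1
      · exact u1
      · rcases u3 with u3 | u3 <;> apply le_antisymm <;> linarith
    · rcases u2 with u2 | u2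
      · rcases u4 with u4 | u4 <;> apply le_antisymm <;> linarith
      · exact u2
  have hS : {x | ∃ t a b, π t = x ∧ GoodAt t a b} ∈ 𝓝 (π t₀) := by
    obtain ⟨r, s, _, _, hr⟩ := key good₀
    rw [← hπ.map_nhds_eq]
    exact hr.mono fun t ht => ⟨t, r t, s t, rfl, ht⟩
  obtain ⟨F, hF1, hF2, hF3, hF4⟩ := exists_isConnected_isOpen_subset hS
  have hcont : ContinuousOn Λ F := by
    intro x hx
    obtain ⟨t, a, b, rfl, h⟩ := hF4 hx
    obtain ⟨r, s, hr, hs, hrs⟩ := key h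
    refine ContinuousAt.continuousWithinAt ?_
    rw [ContinuousAt, hΛ h, ← hπ.map_nhds_eq, tendsto_map'_iff]
    exact (hr.prodMk_nhds hs).congr' (hrs.mono fun t' ht' => (hΛ ht').symm)
  refine ⟨F, fun x => (Λ x).1, fun x => (Λ x).2, hF1, hF2, hF3,
    continuous_fst.comp_continuousOn hcont, continuous_snd.comp_continuousOn hcont,
    by simp only [hΛ good₀], by simp only [hΛ good₀], ?_, ?_⟩
  · intro x hx
    obtain ⟨t, a, b, rfl, h⟩ := hF4 hx
    simp only [hΛ h]
    exact ⟨h.1, h.2.1, h.2.2.1⟩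
  · intro x hx
    obtain ⟨t, a, b, rfl, h⟩ := hF4 hx
    simp only [hΛ h]
    exact ⟨t, rfl, left_of_good h, right_of_good h⟩

end RootBranches

/-! ### Algebra of polynomial families with continuous coefficients. -/

section ContinuousFamilies

variable {T : Type*} [TopologicalSpace T] {G H : T → ℂ[X]}

theorem exists_continuousCoeff_add (hG : ∃ d, ContinuousCoeff G d)
    (hH : ∃ d, ContinuousCoeff H d) : ∃ d, ContinuousCoeff (fun t => G t + H t) d := by
  obtain ⟨m, hm, hm'⟩ := hG
  obtain ⟨n, hn, hn'⟩ := hH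
  refine ⟨max m n, fun t => natDegree_add_le_of_degree_le ((hm t).trans (le_max_left _ _))
    ((hn t).trans (le_max_right _ _)), fun i => ?_⟩
  simp only [coeff_add]
  exact (hm' i).add (hn' i)

theorem exists_continuousCoeff_neg (hG : ∃ d, ContinuousCoeff G d) :
    ∃ d, ContinuousCoeff (fun t => -G t) d := by
  obtain ⟨m, hm, hm'⟩ := hG
  refine ⟨m, fun t => by simpa using hm t, fun i => ?_⟩
  simp only [coeff_neg]
  exact (hm' i).neg

theorem exists_continuousCoeff_sub (hG : ∃ d, ContinuousCoeff G d)
    (hH : ∃ d, ContinuousCoeff H d) : ∃ d, ContinuousCoeff (fun t => G t - H t) d := by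
  simpa only [sub_eq_add_neg] using exists_continuousCoeff_add hG (exists_continuousCoeff_neg hH)

theorem exists_continuousCoeff_mul (hG : ∃ d, ContinuousCoeff G d)
    (hH : ∃ d, ContinuousCoeff H d) : ∃ d, ContinuousCoeff (fun t => G t * H t) d := by
  obtain ⟨m, hm, hm'⟩ := hG
  obtain ⟨n, hn, hn'⟩ := hH
  refine ⟨m + n, fun t => natDegree_mul_le_of_le (hm t) (hn t), fun i => ?_⟩
  simp only [coeff_mul]
  exact continuous_finsetSum _ fun j _ => (hm' j.1).mul (hn' j.2)

theorem exists_continuousCoeff_C {g : T → ℂ} (hg : Continuous g) :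
    ∃ d, ContinuousCoeff (fun t => C (g t)) d := by
  refine ⟨0, fun t => (natDegree_C _).le, fun i => ?_⟩
  simp only [coeff_C]
  split_ifs
  · exact hg
  · exact continuous_const

theorem exists_continuousCoeff_const (p : ℂ[X]) : ∃ d, ContinuousCoeff (fun _ : T => p) d :=
  ⟨p.natDegree, fun _ => le_rfl, fun _ => continuous_const⟩

end ContinuousFamilies

/-! ### The initial value problem and the characteristic polynomial. -/

namespace DiscreteSL

variable {N : ℕ}

namespace SLE

theorem continuous_invf (n : Fin (N + 1)) : Continuous fun ω : SLE N => ω.invf n := by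
  unfold invf; fun_prop

theorem continuous_q (i : Fin N) : Continuous fun ω : SLE N => ω.q i := by
  unfold q; fun_prop

theorem continuous_w (i : Fin N) : Continuous fun ω : SLE N => ω.w i := by
  unfold w; fun_prop

theorem exists_continuousCoeff_solPoly (a b : ℂ) (n : Fin (N + 1)) :
    (∃ d, ContinuousCoeff (fun ω : SLE N => (ω.solPoly a b n).1) d) ∧
      ∃ d, ContinuousCoeff (fun ω : SLE N => (ω.solPoly a b n).2) d := by
  induction n using Fin.induction with
  | zero => exact ⟨exists_continuousCoeff_const (C a), exists_continuousCoeff_const (C b)⟩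
  | succ i ih =>
    have h1 := exists_continuousCoeff_add ih.1
      (exists_continuousCoeff_mul (exists_continuousCoeff_C (continuous_invf i.castSucc)) ih.2)
    refine ⟨h1, exists_continuousCoeff_add ih.2 (exists_continuousCoeff_mul ?_ h1)⟩
    exact exists_continuousCoeff_sub (exists_continuousCoeff_C (continuous_q i))
      (exists_continuousCoeff_mul (exists_continuousCoeff_C (continuous_w i))
        (exists_continuousCoeff_const X))

theorem exists_continuousCoeff_transfer (i j : Fin 2) :
    ∃ d, ContinuousCoeff (fun ω : SLE N => ω.transfer i j) d := by
  have h1 := exists_continuousCoeff_solPoly (N := N) 1 0 (Fin.last N)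
  have h2 := exists_continuousCoeff_solPoly (N := N) 0 1 (Fin.last N)
  fin_cases i <;> fin_cases j
  exacts [h1.1, h2.1, h1.2, h2.2]

theorem eval_solPoly (ω : SLE N) (a b lam : ℂ) (n : Fin (N + 1)) :
    (ω.solPoly a b n).1.eval lam
        = a * (ω.solPoly 1 0 n).1.eval lam + b * (ω.solPoly 0 1 n).1.eval lam ∧
      (ω.solPoly a b n).2.eval lam
        = a * (ω.solPoly 1 0 n).2.eval lam + b * (ω.solPoly 0 1 n).2.eval lam := by
  induction n using Fin.induction with
  | zero => simp [solPoly]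
  | succ i ih =>
    obtain ⟨h1, h2⟩ := ih
    simp only [solPoly, Fin.induction_succ, eval_add, eval_sub, eval_mul, eval_C, eval_X] at h1 h2 ⊢
    rw [h1, h2]
    constructor <;> ring

theorem exists_isSolution (ω : SLE N) (a b lam : ℂ) :
    ∃ y : Fin (N + 2) → ℂ, ω.IsSolution lam y ∧ y 0 = a ∧ ω.quasiDiff y 0 = b := by
  -- `solPoly` stops at n = N; the extra value y_(N+1) = y_N + (1/f_N) · f_N Δy_N is forced by the
  -- last quasi-difference.
  refine ⟨Fin.snoc (fun n : Fin (N + 1) => (ω.solPoly a b n).1.eval lam)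
    ((ω.solPoly a b (Fin.last N)).1.eval lam
      + ω.invf (Fin.last N) * (ω.solPoly a b (Fin.last N)).2.eval lam), ?_⟩
  rw [isSolution_and_init_iff]
  intro n
  have hn : ω.invf n ≠ 0 := ω.2.1 n
  refine ⟨Fin.snoc_castSucc .., ?_⟩
  simp only [quasiDiff, f, Fin.snoc_castSucc]
  induction n using Fin.lastCases with
  | last =>
    rw [Fin.succ_last, Fin.snoc_last]
    field_simp
    ring
  | cast i =>
    rw [Fin.succ_castSucc, Fin.snoc_castSucc]
    simp only [solPoly, Fin.induction_succ, eval_add, eval_mul, eval_C]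
    field_simp
    ring

theorem eq_zero_of_isSolution {ω : SLE N} {lam : ℂ} {y : Fin (N + 2) → ℂ}
    (hy : ω.IsSolution lam y) (h0 : y 0 = 0) (h1 : ω.quasiDiff y 0 = 0) : y = 0 := by
  have h := (ω.isSolution_and_init_iff 0 0 lam y).1 ⟨hy, h0, h1⟩
  have hz : ∀ n, y n.castSucc = 0 ∧ ω.quasiDiff y n = 0 := fun n => by
    rw [(h n).1, (h n).2, (ω.eval_solPoly 0 0 lam n).1, (ω.eval_solPoly 0 0 lam n).2]
    simp
  funext n
  induction n using Fin.lastCases with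
  | last =>
    have h2 := (hz (Fin.last N)).2
    have hf : ω.f (Fin.last N) ≠ 0 := inv_ne_zero (ω.2.1 _)
    rw [quasiDiff, (hz (Fin.last N)).1, sub_zero, Fin.succ_last] at h2
    exact (mul_eq_zero.1 h2).resolve_left hf
  | cast i => exact (hz i).1

end SLE

theorem exists_continuousCoeff_charPoly :
    ∃ d, ContinuousCoeff (fun t : SLE N × BCMatrix => charPoly t.1 t.2) d := by
  have hA : ∀ i j, ∃ d, ContinuousCoeff (fun t : SLE N × BCMatrix => C (t.2.1.1 i j)) d :=
    fun i j => exists_continuousCoeff_C (by fun_prop)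
  have hB : ∀ i j, ∃ d, ContinuousCoeff (fun t : SLE N × BCMatrix => C (t.2.1.2 i j)) d :=
    fun i j => exists_continuousCoeff_C (by fun_prop)
  have hΦ : ∀ i j, ∃ d, ContinuousCoeff (fun t : SLE N × BCMatrix => t.1.transfer i j) d := by
    intro i j
    obtain ⟨d, h1, h2⟩ := SLE.exists_continuousCoeff_transfer (N := N) i j
    exact ⟨d, fun t => h1 t.1, fun k => (h2 k).comp continuous_fst⟩
  have hE : ∀ i j, ∃ d, ContinuousCoeff (fun t : SLE N × BCMatrix =>
      C (t.2.1.1 i j) + (C (t.2.1.2 i 0) * t.1.transfer 0 j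
        + C (t.2.1.2 i 1) * t.1.transfer 1 j)) d := fun i j =>
    exists_continuousCoeff_add (hA i j) (exists_continuousCoeff_add
      (exists_continuousCoeff_mul (hB i 0) (hΦ 0 j)) (exists_continuousCoeff_mul (hB i 1) (hΦ 1 j)))
  simp only [charPoly, det_fin_two, Matrix.add_apply, Matrix.map_apply, mul_apply, Fin.sum_univ_two]
  exact exists_continuousCoeff_sub (exists_continuousCoeff_mul (hE 0 0) (hE 1 1))
    (exists_continuousCoeff_mul (hE 0 1) (hE 1 0))

/-- Solutions correspond to initial vectors Y₀, and Y₁ = Φ_N Y₀, so the boundary condition reads (A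
+ BΦ_N) Y₀ = 0. -/
theorem isEigenvalue_mk_iff (ω : SLE N) (P : BCMatrix) (lam : ℂ) :
    IsEigenvalue ω ⟦P⟧ lam ↔ (charPoly ω P).IsRoot lam := by
  set Φ : Matrix (Fin 2) (Fin 2) ℂ := ω.transfer.map (eval lam) with hΦ
  have hdet : (charPoly ω P).eval lam = (P.1.1 + P.1.2 * Φ).det := by
    simp [charPoly, det_fin_two, mul_apply, Fin.sum_univ_two, hΦ]
  have hend : ∀ y, ω.IsSolution lam y →
      (BC.Holds ⟦P⟧ ![y (0 : Fin (N + 1)).castSucc, ω.quasiDiff y 0]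
          ![y (Fin.last N).castSucc, ω.quasiDiff y (Fin.last N)] ↔
        (P.1.1 + P.1.2 * Φ) *ᵥ ![y 0, ω.quasiDiff y 0] = 0) := by
    intro y hy
    obtain ⟨h1, h2⟩ := (ω.isSolution_and_init_iff _ _ lam y).1 ⟨hy, rfl, rfl⟩ (Fin.last N)
    rw [(ω.eval_solPoly _ _ lam _).1] at h1
    rw [(ω.eval_solPoly _ _ lam _).2] at h2
    have h3 : ![y (Fin.last N).castSucc, ω.quasiDiff y (Fin.last N)]
        = Φ *ᵥ ![y 0, ω.quasiDiff y 0] := by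
      rw [h1, h2]
      ext i
      fin_cases i <;> simp [hΦ, mulVec, dotProduct, Fin.sum_univ_two, SLE.transfer, mul_comm]
    rw [h3, add_mulVec, ← mulVec_mulVec]
    rfl
  rw [IsRoot, hdet, ← exists_mulVec_eq_zero_iff]
  constructor
  · rintro ⟨y, hy0, hy, hbc⟩
    refine ⟨_, fun h => hy0 ?_, (hend y hy).1 hbc⟩
    exact SLE.eq_zero_of_isSolution hy (by simpa using congrFun h 0) (by simpa using congrFun h 1)
  · rintro ⟨v, hv, hv'⟩
    obtain ⟨y, hy, h0, h1⟩ := ω.exists_isSolution (v 0) (v 1) lam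
    have e : ![y 0, ω.quasiDiff y 0] = v := by
      rw [h0, h1]
      ext i
      fin_cases i <;> rfl
    refine ⟨y, ?_, hy, (hend y hy).2 (by rwa [e])⟩
    rintro rfl
    refine hv (e ▸ ?_)
    ext i
    fin_cases i <;> simp [SLE.quasiDiff]

/-! ### Self-adjoint boundary conditions -/

theorem symplE_mul_conjTranspose : symplE * symplEᴴ = 1 := by
  ext i j
  fin_cases i <;> fin_cases j <;> simp [symplE, mul_apply, Fin.sum_univ_two]

theorem conjTranspose_symplE : symplEᴴ = -symplE := by
  ext i j
  fin_cases i <;> fin_cases j <;> simp [symplE]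

/-- The Gram matrix `A A* + B B*`. -/
def gram (P : Matrix (Fin 2) (Fin 2) ℂ × Matrix (Fin 2) (Fin 2) ℂ) : Matrix (Fin 2) (Fin 2) ℂ :=
  P.1 * P.1ᴴ + P.2 * P.2ᴴ

-- The Gram matrix is M M* for M = (A, B), so it has the rank of M. This turns the rank condition
-- into an open one and supplies an inverse.
open scoped ComplexOrder in
theorem rank_fromCols_eq_two_iff (P : Matrix (Fin 2) (Fin 2) ℂ × Matrix (Fin 2) (Fin 2) ℂ) :
    (fromCols P.1 P.2).rank = 2 ↔ IsUnit (gram P).det := by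
  have h : (gram P).rank = (fromCols P.1 P.2).rank := by
    rw [← rank_self_mul_conjTranspose (fromCols P.1 P.2), conjTranspose_fromCols_eq_fromRows_conjTranspose,
      fromCols_mul_fromRows, gram]
  rw [← h]
  constructor
  · intro h2
    rw [← isUnit_iff_isUnit_det]
    have h3 : (gram P).mulVecLin.range = ⊤ := by
      apply Submodule.eq_top_of_finrank_eq
      rw [← Matrix.rank, h2]
      simp
    exact mulVec_surjective_iff_isUnit.1 (LinearMap.range_eq_top.1 h3)
  · intro h2
    rw [rank_of_isUnit _ ((isUnit_iff_isUnit_det _).2 h2)]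
    simp

theorem isUnit_det_gram (P : BCMatrix) : IsUnit (gram P.1).det :=
  (rank_fromCols_eq_two_iff _).1 P.2

/-- A self-adjoint boundary matrix `(A, B)` and `(A E, -B E)` together span, with dual matrix given
by their adjoints. -/
theorem selfAdjoint_resolution (P : BCMatrix)
    (hP : P.1.1 * symplE * P.1.1ᴴ = P.1.2 * symplE * P.1.2ᴴ) :
    (P.1.1ᴴ * (gram P.1)⁻¹ * P.1.1 + symplEᴴ * P.1.1ᴴ * (gram P.1)⁻¹ * (P.1.1 * symplE) = 1 ∧
      P.1.1ᴴ * (gram P.1)⁻¹ * P.1.2 - symplEᴴ * P.1.1ᴴ * (gram P.1)⁻¹ * (P.1.2 * symplE) = 0) ∧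
    (P.1.2ᴴ * (gram P.1)⁻¹ * P.1.1 - symplEᴴ * P.1.2ᴴ * (gram P.1)⁻¹ * (P.1.1 * symplE) = 0 ∧
      P.1.2ᴴ * (gram P.1)⁻¹ * P.1.2 + symplEᴴ * P.1.2ᴴ * (gram P.1)⁻¹ * (P.1.2 * symplE) = 1) := by
  have hS : gram P.1 * (gram P.1)⁻¹ = 1 := mul_nonsing_inv _ (isUnit_det_gram P)
  obtain ⟨⟨A, B⟩, hrk⟩ := P
  simp only at hP hS ⊢
  set R := (gram (A, B))⁻¹ with hR
  have hS' : A * Aᴴ * R + B * Bᴴ * R = 1 := by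
    rw [← add_mul]
    exact hS
  have hE1 : A * symplE * (symplEᴴ * Aᴴ * R) = A * Aᴴ * R := by
    rw [show A * symplE * (symplEᴴ * Aᴴ * R) = A * (symplE * symplEᴴ) * Aᴴ * R by noncomm_ring,
      symplE_mul_conjTranspose, mul_one]
  have hE2 : B * symplE * (symplEᴴ * Bᴴ * R) = B * Bᴴ * R := by
    rw [show B * symplE * (symplEᴴ * Bᴴ * R) = B * (symplE * symplEᴴ) * Bᴴ * R by noncomm_ring,
      symplE_mul_conjTranspose, mul_one]
  -- Self-adjointness kills the off-diagonal blocks. A right inverse of a square matrix is also a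
  -- left inverse, and the product in the other order gives the four identities.
  have key : fromBlocks A B (A * symplE) (-(B * symplE)) *
      fromBlocks (Aᴴ * R) (symplEᴴ * Aᴴ * R) (Bᴴ * R) (-(symplEᴴ * Bᴴ * R)) = 1 := by
    rw [fromBlocks_multiply, ← fromBlocks_one, fromBlocks_inj]
    refine ⟨?_, ?_, ?_, ?_⟩
    · rw [← hS']; noncomm_ring
    · rw [conjTranspose_symplE,
        show A * (-symplE * Aᴴ * R) + B * -(-symplE * Bᴴ * R)
          = (B * symplE * Bᴴ - A * symplE * Aᴴ) * R by noncomm_ring, hP, sub_self, zero_mul]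
    · rw [show A * symplE * (Aᴴ * R) + -(B * symplE) * (Bᴴ * R)
          = (A * symplE * Aᴴ - B * symplE * Bᴴ) * R by noncomm_ring, hP, sub_self, zero_mul]
    · rw [neg_mul_neg, hE1, hE2, hS']
  have key' := mul_eq_one_comm.1 key
  rw [fromBlocks_multiply, ← fromBlocks_one, fromBlocks_inj] at key'
  obtain ⟨k1, k2, k3, k4⟩ := key'
  refine ⟨⟨k1, ?_⟩, ?_, ?_⟩
  · rw [← k2]; noncomm_ring
  · rw [← k3]; noncomm_ring
  · rw [← k4]; noncomm_ring

/-- The kernel of (A, B) is parametrized by Y₀ = E*A*c, Y₁ = -E*B*c, which turns the two sides into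
c*(AEA*)c and c*(BEB*)c. -/
theorem selfAdjoint_boundary_form (P : BCMatrix)
    (hP : P.1.1 * symplE * P.1.1ᴴ = P.1.2 * symplE * P.1.2ᴴ) {Y₀ Y₁ : Fin 2 → ℂ}
    (hY : P.1.1 *ᵥ Y₀ + P.1.2 *ᵥ Y₁ = 0) :
    star Y₀ ⬝ᵥ symplE *ᵥ Y₀ = star Y₁ ⬝ᵥ symplE *ᵥ Y₁ := by
  obtain ⟨⟨k1, k2⟩, k3, k4⟩ := selfAdjoint_resolution P hP
  obtain ⟨⟨A, B⟩, hrk⟩ := P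
  simp only at hP hY k1 k2 k3 k4
  set R := (gram (A, B))⁻¹ with hR
  set c := R *ᵥ ((A * symplE) *ᵥ Y₀ - (B * symplE) *ᵥ Y₁) with hc
  have h0 : Y₀ = (symplEᴴ * Aᴴ) *ᵥ c := by
    have : Y₀ = (1 : Matrix (Fin 2) (Fin 2) ℂ) *ᵥ Y₀ + (0 : Matrix (Fin 2) (Fin 2) ℂ) *ᵥ Y₁ := by
      simp
    rw [← k1, ← k2] at this
    calc Y₀ = (Aᴴ * R) *ᵥ (A *ᵥ Y₀ + B *ᵥ Y₁) + (symplEᴴ * Aᴴ) *ᵥ c := by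
          rw [hc]
          simp only [mulVec_add, mulVec_sub, mulVec_mulVec, add_mulVec, sub_mulVec] at this ⊢
          simp only [Matrix.mul_assoc] at this ⊢
          conv_lhs => rw [this]
          abel
      _ = _ := by rw [hY, mulVec_zero, zero_add]
  have h1 : Y₁ = (-(symplEᴴ * Bᴴ)) *ᵥ c := by
    have : Y₁ = (0 : Matrix (Fin 2) (Fin 2) ℂ) *ᵥ Y₀ + (1 : Matrix (Fin 2) (Fin 2) ℂ) *ᵥ Y₁ := by
      simp
    rw [← k3, ← k4] at this
    calc Y₁ = (Bᴴ * R) *ᵥ (A *ᵥ Y₀ + B *ᵥ Y₁) + (-(symplEᴴ * Bᴴ)) *ᵥ c := by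
          rw [hc]
          simp only [mulVec_add, mulVec_sub, mulVec_mulVec, add_mulVec, sub_mulVec]
            at this ⊢
          simp only [Matrix.neg_mul, neg_mulVec, Matrix.mul_assoc] at this ⊢
          conv_lhs => rw [this]
          abel
      _ = _ := by rw [hY, mulVec_zero, zero_add]
  have form : ∀ M : Matrix (Fin 2) (Fin 2) ℂ,
      star ((symplEᴴ * Mᴴ) *ᵥ c) ⬝ᵥ symplE *ᵥ ((symplEᴴ * Mᴴ) *ᵥ c)
        = star c ⬝ᵥ (M * symplE * Mᴴ) *ᵥ c := by
    intro M
    rw [star_mulVec, ← dotProduct_mulVec, mulVec_mulVec, mulVec_mulVec, conjTranspose_mul,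
      conjTranspose_conjTranspose, conjTranspose_conjTranspose,
      show M * symplE * symplE * (symplEᴴ * Mᴴ) = M * symplE * (symplE * symplEᴴ) * Mᴴ by
        noncomm_ring, symplE_mul_conjTranspose, Matrix.mul_one]
  rw [h0, h1, neg_mulVec, star_neg, mulVec_neg, neg_dotProduct_neg, form, form, hP]

theorem im_star_mul_eq_of_holds {bc : BC} (hbc : bc.IsSelfAdjoint) {a b a' b' : ℂ}
    (h : bc.Holds ![a, b] ![a', b']) : (star a * b).im = (star a' * b').im := by
  induction bc using Quotient.inductionOn with
  | h P =>
    have := selfAdjoint_boundary_form P hbc h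
    have := congrArg Complex.im this
    simp [symplE, mulVec, dotProduct, Fin.sum_univ_two] at this ⊢
    linarith

/-- Lagrange identity: `g` grows by (Im λ)² w_n |y_n|² at each step, yet has equal end values. If Im
λ ≠ 0, then y_1 = … = y_N = 0. -/
theorem im_eq_zero_of_isEigenvalue (hN : 2 ≤ N) {ω : SLE N} (hω : ω ∈ SLE.realPos N) {bc : BC}
    (hbc : bc.IsSelfAdjoint) {lam : ℂ} (h : IsEigenvalue ω bc lam) : lam.im = 0 := by
  obtain ⟨y, hy0, hy, hbd⟩ := h
  by_contra him
  obtain ⟨hr, hq, hw⟩ := hω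
  set g : Fin (N + 1) → ℝ :=
    fun n => -lam.im * (star (y n.castSucc) * ω.quasiDiff y n).im with hg
  have hstep : ∀ i : Fin N, g i.succ
      = g i.castSucc + lam.im ^ 2 * (ω.w i).re * Complex.normSq (y i.succ.castSucc) := by
    intro i
    have h : ω.invf i.castSucc ≠ 0 := ω.2.1 i.castSucc
    have h1 : y i.castSucc.castSucc
        = y i.succ.castSucc - ω.invf i.castSucc * ω.quasiDiff y i.castSucc := by
      simp only [SLE.quasiDiff, SLE.f, Fin.succ_castSucc]
      field_simp
      ring
    have h2 : ω.quasiDiff y i.succ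
        = ω.quasiDiff y i.castSucc + (ω.q i - lam * ω.w i) * y i.succ.castSucc := by
      linear_combination -(hy i)
    simp only [hg]
    rw [h1, h2]
    generalize y i.succ.castSucc = u
    generalize ω.quasiDiff y i.castSucc = v
    simp only [Complex.star_def, map_sub, map_mul, Complex.mul_im, Complex.mul_re, Complex.add_re,
      Complex.add_im, Complex.sub_re, Complex.sub_im, Complex.conj_re, Complex.conj_im, hr, hq,
      (hw i).1, Complex.normSq_apply]
    ring
  have hmono : Monotone g := Fin.monotone_iff_le_succ.2 fun i => by
    rw [hstep]
    have := (hw i).2.le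
    have := Complex.normSq_nonneg (y i.succ.castSucc)
    exact le_add_of_nonneg_right (by positivity)
  have hends : g 0 = g (Fin.last N) := by
    simp only [hg]
    rw [im_star_mul_eq_of_holds hbc hbd]
  have hyz : ∀ i : Fin N, y i.succ.castSucc = 0 := by
    intro i
    have h1 : g i.succ ≤ g i.castSucc :=
      (hmono (Fin.le_last _)).trans (hends ▸ hmono (Fin.zero_le _))
    rw [hstep] at h1
    have h2 := (hw i).2
    have h3 : lam.im ^ 2 * (ω.w i).re * Complex.normSq (y i.succ.castSucc) ≤ 0 := by linarith
    have h4 : 0 < lam.im ^ 2 * (ω.w i).re := by positivity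
    have h5 := Complex.normSq_nonneg (y i.succ.castSucc)
    refine Complex.normSq_eq_zero.1 (le_antisymm ?_ h5)
    by_contra! hc
    exact absurd (mul_pos h4 hc) (not_lt.2 h3)
  -- With N ≥ 2 both y_1 and y_2 vanish, so f_1 Δy_1 = 0; the equation at n = 1 then gives f_0 Δy_0
  -- = 0, whence y_0 = 0.
  obtain ⟨n, rfl⟩ : ∃ n, N = n + 2 := ⟨N - 2, by omega⟩
  have e1 : ω.quasiDiff y 1 = 0 := by
    have a1 := hyz 0
    have a2 := hyz 1
    rw [SLE.quasiDiff]
    have b1 : (1 : Fin (n + 3)).succ = (1 : Fin (n + 2)).succ.castSucc := rfl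
    have b2 : (1 : Fin (n + 3)).castSucc = (0 : Fin (n + 2)).succ.castSucc := rfl
    rw [b1, b2, a1, a2, sub_zero, mul_zero]
  have e0 : ω.quasiDiff y 0 = 0 := by
    have a0 := hy 0
    rw [hyz 0, mul_zero, mul_zero, add_zero, neg_eq_zero, sub_eq_zero] at a0
    exact a0.symm.trans e1
  refine hy0 (SLE.eq_zero_of_isSolution hy ?_ e0)
  have hf : ω.f 0 ≠ 0 := inv_ne_zero (ω.2.1 _)
  have b1 : (0 : Fin (n + 3)).succ = (0 : Fin (n + 2)).succ.castSucc := rfl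
  rw [SLE.quasiDiff, b1, hyz 0, zero_sub, mul_eq_zero, or_iff_right hf, neg_eq_zero] at e0
  exact e0

end DiscreteSL

/-! ### Local path connectedness and the quotient map. -/

theorem locallyPathConnectedSpace_of_charts {Y : Type*} [TopologicalSpace Y]
    (h : ∀ y : Y, ∃ (V : Type) (_ : TopologicalSpace V) (_ : LocallyPathConnectedSpace V)
      (f : V → Y) (v : V), Continuous f ∧ f v = y ∧ 𝓝 y ≤ map f (𝓝 v)) :
    LocallyPathConnectedSpace Y where
  path_connected_basis y := by
    rw [hasBasis_self]
    intro W hW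
    obtain ⟨V, _, _, f, v, hf, rfl, hfv⟩ := h y
    obtain ⟨U, ⟨hU1, hU2⟩, hU3⟩ := (LocallyPathConnectedSpace.path_connected_basis v).mem_iff.1
      (hf.continuousAt.preimage_mem_nhds hW)
    exact ⟨f '' U, hfv (image_mem_map hU1), hU2.image hf, Set.image_subset_iff.2 hU3⟩

namespace DiscreteSL

variable {N : ℕ}

instance SLE.locallyPathConnectedSpace : LocallyPathConnectedSpace (SLE N) := by
  have h1 : IsOpen {p : (Fin (N + 1) → ℂ) × (Fin N → ℂ) × (Fin N → ℂ) |
      (∀ n, p.1 n ≠ 0) ∧ (∀ i, p.2.2 i ≠ 0)} := by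
    simp only [Set.ofPred_and, Set.ofPred_forall]
    exact (isOpen_iInter_of_finite fun n => isOpen_ne_fun (by fun_prop) continuous_const).inter
      (isOpen_iInter_of_finite fun i => isOpen_ne_fun (by fun_prop) continuous_const)
  exact h1.locallyPathConnectedSpace

instance SLE.realPos_locallyPathConnectedSpace :
    LocallyPathConnectedSpace (SLE.realPos N) := by
  have h1 : IsOpen {p : (Fin (N + 1) → ℝ) × (Fin N → ℝ) × (Fin N → ℝ) |
      (∀ n, p.1 n ≠ 0) ∧ (∀ i, 0 < p.2.2 i)} := by
    simp only [Set.ofPred_and, Set.ofPred_forall]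
    exact (isOpen_iInter_of_finite fun n => isOpen_ne_fun (by fun_prop) continuous_const).inter
      (isOpen_iInter_of_finite fun i => isOpen_lt continuous_const (by fun_prop))
  have := h1.locallyPathConnectedSpace
  let toReal : SLE.realPos N → {p : (Fin (N + 1) → ℝ) × (Fin N → ℝ) × (Fin N → ℝ) |
      (∀ n, p.1 n ≠ 0) ∧ (∀ i, 0 < p.2.2 i)} := fun ω =>
    ⟨(fun n => (ω.1.1.1 n).re, fun i => (ω.1.1.2.1 i).re, fun i => (ω.1.1.2.2 i).re),
      fun n h => ω.1.2.1 n (Complex.ext h (ω.2.1 n)), fun i => (ω.2.2.2 i).2⟩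
  let ofReal : {p : (Fin (N + 1) → ℝ) × (Fin N → ℝ) × (Fin N → ℝ) |
      (∀ n, p.1 n ≠ 0) ∧ (∀ i, 0 < p.2.2 i)} → SLE.realPos N := fun p =>
    ⟨⟨(fun n => (p.1.1 n : ℂ), fun i => (p.1.2.1 i : ℂ), fun i => (p.1.2.2 i : ℂ)),
      fun n => Complex.ofReal_ne_zero.2 (p.2.1 n),
      fun i => Complex.ofReal_ne_zero.2 (p.2.2 i).ne'⟩,
      fun n => Complex.ofReal_im _, fun i => Complex.ofReal_im _,
      fun i => ⟨Complex.ofReal_im _, by simpa [SLE.w] using p.2.2 i⟩⟩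
  have c1 : Continuous toReal := by fun_prop
  have c2 : Continuous ofReal := by fun_prop
  have hinv : Function.LeftInverse ofReal toReal := by
    intro ω
    ext1; ext1
    refine Prod.ext (funext fun n => ?_) (Prod.ext (funext fun i => ?_) (funext fun i => ?_))
    · exact Complex.ext (Complex.ofReal_re _) (ω.2.1 n).symm
    · exact Complex.ext (Complex.ofReal_re _) (ω.2.2.1 i).symm
    · exact Complex.ext (Complex.ofReal_re _) (ω.2.2.2 i).1.symm
  exact (IsQuotientMap.of_inverse c1 c2 hinv).locallyPathConnectedSpace

instance locallyConvexSpace_matrix : LocallyConvexSpace ℝ (Matrix (Fin 2) (Fin 2) ℂ) :=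
  inferInstanceAs (LocallyConvexSpace ℝ (Fin 2 → Fin 2 → ℂ))

instance BCMatrix.locallyPathConnectedSpace : LocallyPathConnectedSpace BCMatrix := by
  have h1 : IsOpen {P : Matrix (Fin 2) (Fin 2) ℂ × Matrix (Fin 2) (Fin 2) ℂ |
      (fromCols P.1 P.2).rank = 2} := by
    simp only [rank_fromCols_eq_two_iff, isUnit_iff_ne_zero, gram]
    exact isOpen_ne_fun (by fun_prop) continuous_const
  exact h1.locallyPathConnectedSpace

theorem rank_fromCols_eq_two {A B A' B' : Matrix (Fin 2) (Fin 2) ℂ} (h : A * A' + B * B' = 1) :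
    (fromCols A B).rank = 2 := by
  have h1 := rank_mul_le_left (fromCols A B) (fromRows A' B')
  rw [fromCols_mul_fromRows, h, rank_one, Fintype.card_fin] at h1
  exact le_antisymm ((rank_le_card_height _).trans_eq (by simp)) h1

theorem gram_mul_inv (P : BCMatrix) : gram P.1 * (gram P.1)⁻¹ = 1 :=
  mul_nonsing_inv _ (isUnit_det_gram P)

theorem inv_mul_gram (P : BCMatrix) : (gram P.1)⁻¹ * gram P.1 = 1 :=
  nonsing_inv_mul _ (isUnit_det_gram P)

/-- The action of `GL(2, ℂ)` on boundary matrices. -/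
def BCMatrix.act (T : GL (Fin 2) ℂ) (P : BCMatrix) : BCMatrix :=
  ⟨((T : Matrix (Fin 2) (Fin 2) ℂ) * P.1.1, (T : Matrix (Fin 2) (Fin 2) ℂ) * P.1.2), by
    refine rank_fromCols_eq_two
      (A' := P.1.1ᴴ * (gram P.1)⁻¹ * ((T⁻¹ : GL (Fin 2) ℂ) : Matrix (Fin 2) (Fin 2) ℂ))
      (B' := P.1.2ᴴ * (gram P.1)⁻¹ * ((T⁻¹ : GL (Fin 2) ℂ) : Matrix (Fin 2) (Fin 2) ℂ)) ?_
    generalize hT' : ((T⁻¹ : GL (Fin 2) ℂ) : Matrix (Fin 2) (Fin 2) ℂ) = T'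
    have h1 : (T : Matrix (Fin 2) (Fin 2) ℂ) * T' = 1 := by
      rw [← hT', ← Units.val_mul, mul_inv_cancel, Units.val_one]
    have h2 := gram_mul_inv P
    generalize (gram P.1)⁻¹ = R at h2
    calc _ = (T : Matrix (Fin 2) (Fin 2) ℂ) * ((P.1.1 * P.1.1ᴴ + P.1.2 * P.1.2ᴴ) * R) * T' := by
          noncomm_ring
      _ = 1 := by rw [show P.1.1 * P.1.1ᴴ + P.1.2 * P.1.2ᴴ = gram P.1 from rfl, h2, mul_one, h1]⟩

theorem BCMatrix.continuous_act (T : GL (Fin 2) ℂ) : Continuous (BCMatrix.act T) := by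
  unfold BCMatrix.act; fun_prop

/-- The saturation of an open set is a union of preimages under the continuous maps `BCMatrix.act
T`. -/
theorem isOpenQuotientMap_mk : IsOpenQuotientMap (Quotient.mk bcSetoid) := by
  refine ⟨Quotient.mk_surjective, continuous_quotient_mk', fun U hU => ?_⟩
  change IsOpen (Quotient.mk bcSetoid ⁻¹' (Quotient.mk bcSetoid '' U))
  have : (Quotient.mk bcSetoid) ⁻¹' (Quotient.mk bcSetoid '' U)
      = ⋃ T : GL (Fin 2) ℂ, BCMatrix.act T ⁻¹' U := by
    ext P
    simp only [Set.mem_preimage, Set.mem_image, Set.mem_iUnion]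
    constructor
    · rintro ⟨Q, hQ, hQP⟩
      obtain ⟨T, h1, h2⟩ := Quotient.exact hQP.symm
      have : BCMatrix.act T P = Q := Subtype.ext (Prod.ext h1.symm h2.symm)
      exact ⟨T, this ▸ hQ⟩
    · rintro ⟨T, hT⟩
      exact ⟨_, hT, (Quotient.sound ⟨T, rfl, rfl⟩ : (⟦P⟧ : BC) = ⟦BCMatrix.act T P⟧).symm⟩
  rw [this]
  exact isOpen_iUnion fun T => hU.preimage (BCMatrix.continuous_act T)

/-! ### Charts of the space of self-adjoint boundary conditions -/

/-- For a boundary matrix `P = (A, B)` with Gram matrix `S` and a matrix `H`, the pair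
`(S⁻¹ A + H A E, S⁻¹ B - H B E)`. -/
noncomputable def chartMatrix (P : BCMatrix) (H : Matrix (Fin 2) (Fin 2) ℂ) :
    Matrix (Fin 2) (Fin 2) ℂ × Matrix (Fin 2) (Fin 2) ℂ :=
  ((gram P.1)⁻¹ * P.1.1 + H * (P.1.1 * symplE), (gram P.1)⁻¹ * P.1.2 - H * (P.1.2 * symplE))

theorem rank_chartMatrix {P : BCMatrix}
    (hP : P.1.1 * symplE * P.1.1ᴴ = P.1.2 * symplE * P.1.2ᴴ) (H : Matrix (Fin 2) (Fin 2) ℂ) :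
    (fromCols (chartMatrix P H).1 (chartMatrix P H).2).rank = 2 := by
  refine rank_fromCols_eq_two (A' := P.1.1ᴴ) (B' := P.1.2ᴴ) ?_
  have h := inv_mul_gram P
  rw [chartMatrix]
  generalize (gram P.1)⁻¹ = R at h
  calc _ = R * (P.1.1 * P.1.1ᴴ + P.1.2 * P.1.2ᴴ)
        + H * (P.1.1 * symplE * P.1.1ᴴ - P.1.2 * symplE * P.1.2ᴴ) := by noncomm_ring
    _ = 1 := by
      rw [hP, sub_self, mul_zero, add_zero]
      exact h

/-- Hence the chart point is self-adjoint exactly when H is Hermitian: the rows of (A, B) and of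
(AE, -BE) span complementary Lagrangian planes, and H is the matrix of a graph over the first. -/
theorem chartMatrix_form {P : BCMatrix}
    (hP : P.1.1 * symplE * P.1.1ᴴ = P.1.2 * symplE * P.1.2ᴴ) (H : Matrix (Fin 2) (Fin 2) ℂ) :
    (chartMatrix P H).1 * symplE * (chartMatrix P H).1ᴴ
      - (chartMatrix P H).2 * symplE * (chartMatrix P H).2ᴴ = Hᴴ - H := by
  have h1 := inv_mul_gram P
  have h2 := gram_mul_inv P
  have hherm : ((gram P.1)⁻¹)ᴴ = (gram P.1)⁻¹ := by
    rw [conjTranspose_nonsing_inv]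
    simp [gram]
  rw [chartMatrix]
  generalize (gram P.1)⁻¹ = R at h1 h2 hherm
  simp only [conjTranspose_add, conjTranspose_sub, conjTranspose_mul, hherm]
  have e1 := symplE_mul_conjTranspose
  have e2 : symplE * symplE = -1 := by
    rw [conjTranspose_symplE, mul_neg] at e1
    rw [← e1, neg_neg]
  -- The sign s is 1 for the A-part and -1 for the B-part.
  have key : ∀ M : Matrix (Fin 2) (Fin 2) ℂ, ∀ s : ℂ, s * s = 1 →
      (R * M + s • (H * (M * symplE))) * symplE * (Mᴴ * R + s • (symplEᴴ * Mᴴ * Hᴴ))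
        = R * (M * symplE * Mᴴ) * R + H * (M * symplE * Mᴴ) * Hᴴ
          + s • (R * (M * Mᴴ) * Hᴴ - H * (M * Mᴴ) * R) := by
    intro M s hs
    calc _ = R * (M * symplE * Mᴴ) * R
          + (s * s) • (H * M * (symplE * symplE) * symplEᴴ * Mᴴ * Hᴴ)
          + s • (R * M * (symplE * symplEᴴ) * Mᴴ * Hᴴ
            + H * M * (symplE * symplE) * Mᴴ * R) := by
          simp only [Matrix.mul_add, Matrix.add_mul, Matrix.mul_smul, Matrix.smul_mul, smul_smul,
            smul_add, Matrix.mul_assoc]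
          abel
      _ = _ := by
          rw [hs, e1, e2, conjTranspose_symplE, one_smul]
          noncomm_ring
  have kA := key P.1.1 1 (by norm_num)
  have kB := key P.1.2 (-1) (by norm_num)
  simp only [one_smul, neg_smul, ← sub_eq_add_neg] at kA kB
  rw [kA, kB, hP]
  calc _ = R * (P.1.1 * P.1.1ᴴ + P.1.2 * P.1.2ᴴ) * Hᴴ
        - H * ((P.1.1 * P.1.1ᴴ + P.1.2 * P.1.2ᴴ) * R) := by noncomm_ring
    _ = Hᴴ - H := by
      rw [show P.1.1 * P.1.1ᴴ + P.1.2 * P.1.2ᴴ = gram P.1 from rfl, h1, h2, one_mul, mul_one]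

/-- K and KH are the coordinates of Q along S⁻¹(A, B) and (AE, -BE), where S is the Gram matrix,
read off from the dual matrix in `selfAdjoint_resolution`. When K is invertible, Q is thus
equivalent to a chart point. -/
theorem eq_mul_chartMatrix {P : BCMatrix}
    (hP : P.1.1 * symplE * P.1.1ᴴ = P.1.2 * symplE * P.1.2ᴴ)
    (Q : Matrix (Fin 2) (Fin 2) ℂ × Matrix (Fin 2) (Fin 2) ℂ)
    {K H : Matrix (Fin 2) (Fin 2) ℂ} (hK : K = Q.1 * P.1.1ᴴ + Q.2 * P.1.2ᴴ)
    (hH : K * H = (Q.1 * (symplEᴴ * P.1.1ᴴ) - Q.2 * (symplEᴴ * P.1.2ᴴ)) * (gram P.1)⁻¹) :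
    Q.1 = K * (chartMatrix P H).1 ∧ Q.2 = K * (chartMatrix P H).2 := by
  obtain ⟨⟨k1, k2⟩, k3, k4⟩ := selfAdjoint_resolution P hP
  rw [chartMatrix]
  generalize (gram P.1)⁻¹ = R at *
  constructor
  · rw [mul_add, ← mul_assoc K H, hH, hK]
    calc Q.1 = Q.1 * 1 + Q.2 * 0 := by simp
      _ = _ := by
        rw [← k1, ← k3]
        noncomm_ring
  · rw [mul_sub, ← mul_assoc K H, hH, hK]
    calc Q.2 = Q.1 * 0 + Q.2 * 1 := by simp
      _ = _ := by
        rw [← k2, ← k4]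
        noncomm_ring

instance selfAdjointBC_locallyPathConnectedSpace : LocallyPathConnectedSpace selfAdjointBC := by
  refine locallyPathConnectedSpace_of_charts ?_
  rintro ⟨bc, hbc⟩
  induction bc using Quotient.inductionOn with
  | h P =>
  have hP : P.1.1 * symplE * P.1.1ᴴ = P.1.2 * symplE * P.1.2ᴴ := hbc
  have hconv : Convex ℝ {H : Matrix (Fin 2) (Fin 2) ℂ | Hᴴ = H} := by
    intro H hH H' hH' a b _ _ _
    have h1 : Hᴴ = H := hH
    have h2 : H'ᴴ = H' := hH'
    change (a • H + b • H')ᴴ = a • H + b • H'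
    rw [conjTranspose_add, conjTranspose_smul, conjTranspose_smul, h1, h2, star_trivial,
      star_trivial]
  let f : {H : Matrix (Fin 2) (Fin 2) ℂ | Hᴴ = H} → selfAdjointBC := fun H =>
    ⟨⟦⟨chartMatrix P H.1, rank_chartMatrix hP H.1⟩⟧, by
      have h1 := chartMatrix_form hP H.1
      have h2 : H.1ᴴ = H.1 := H.2
      rw [h2, sub_self, sub_eq_zero] at h1
      exact h1⟩
  have hf : Continuous f := by
    refine Continuous.subtype_mk (continuous_quotient_mk'.comp (Continuous.subtype_mk ?_ _)) _
    unfold chartMatrix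
    fun_prop
  let R := (gram P.1)⁻¹
  let K : BCMatrix → Matrix (Fin 2) (Fin 2) ℂ := fun Q => Q.1.1 * P.1.1ᴴ + Q.1.2 * P.1.2ᴴ
  let L : BCMatrix → Matrix (Fin 2) (Fin 2) ℂ := fun Q =>
    (Q.1.1 * (symplEᴴ * P.1.1ᴴ) - Q.1.2 * (symplEᴴ * P.1.2ᴴ)) * R
  have hKP : IsUnit (K P).det := isUnit_det_gram P
  have hLP : L P = 0 := by
    change (P.1.1 * (symplEᴴ * P.1.1ᴴ) - P.1.2 * (symplEᴴ * P.1.2ᴴ)) * R = 0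
    rw [conjTranspose_symplE,
      show P.1.1 * (-symplE * P.1.1ᴴ) - P.1.2 * (-symplE * P.1.2ᴴ)
        = P.1.2 * symplE * P.1.2ᴴ - P.1.1 * symplE * P.1.1ᴴ by noncomm_ring, hP, sub_self,
      zero_mul]
  have hK : Continuous K := by fun_prop
  have hL : Continuous L := by fun_prop
  -- The inverse of the chart is K⁻¹L, continuous where K is invertible and 0 at P.
  have hchart : ∀ Q : BCMatrix, (Quotient.mk bcSetoid Q : BC) ∈ selfAdjointBC →
      IsUnit (K Q).det → ∃ H : {H : Matrix (Fin 2) (Fin 2) ℂ | Hᴴ = H},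
        H.1 = (K Q)⁻¹ * L Q ∧ (f H : BC) = ⟦Q⟧ := by
    intro Q hQ hu
    have hKL : K Q * ((K Q)⁻¹ * L Q) = L Q := by
      rw [← mul_assoc, mul_nonsing_inv _ hu, one_mul]
    obtain ⟨e1, e2⟩ := eq_mul_chartMatrix hP Q.1 rfl hKL
    have heq : (⟦⟨chartMatrix P ((K Q)⁻¹ * L Q), rank_chartMatrix hP _⟩⟧ : BC) = ⟦Q⟧ :=
      Quotient.sound ⟨nonsingInvUnit (K Q) hu, e1, e2⟩
    refine ⟨⟨(K Q)⁻¹ * L Q, ?_⟩, rfl, heq⟩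
    have h1 := chartMatrix_form hP ((K Q)⁻¹ * L Q)
    have h2 : (chartMatrix P ((K Q)⁻¹ * L Q)).1 * symplE * (chartMatrix P ((K Q)⁻¹ * L Q)).1ᴴ
        = (chartMatrix P ((K Q)⁻¹ * L Q)).2 * symplE
          * (chartMatrix P ((K Q)⁻¹ * L Q)).2ᴴ := by
      rw [← heq] at hQ
      exact hQ
    rw [h2, sub_self] at h1
    exact (sub_eq_zero.1 h1.symm)
  have h0 : (0 : Matrix (Fin 2) (Fin 2) ℂ) ∈ {H : Matrix (Fin 2) (Fin 2) ℂ | Hᴴ = H} :=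
    conjTranspose_zero
  refine ⟨_, inferInstance, hconv.locallyPathConnectedSpace, f, ⟨0, h0⟩, hf, ?_, ?_⟩
  · obtain ⟨H, h1, h2⟩ := hchart P hbc hKP
    have : H = ⟨0, h0⟩ := Subtype.ext (by rw [h1, hLP, mul_zero])
    exact Subtype.ext (this ▸ h2)
  · intro W hW
    rw [mem_map, mem_nhds_subtype] at hW
    obtain ⟨U, hU, hUW⟩ := hW
    have hcont : ContinuousAt (fun Q => (K Q)⁻¹ * L Q) P := by
      refine ContinuousAt.mul (ContinuousAt.comp (g := Inv.inv) (continuousAt_matrix_inv _ ?_)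
        hK.continuousAt) hL.continuousAt
      rw [Ring.inverse_eq_inv']
      exact continuousAt_inv₀ hKP.ne_zero
    have hmem : ∀ᶠ Q in 𝓝 P, IsUnit (K Q).det ∧ (K Q)⁻¹ * L Q ∈ U := by
      refine Filter.Eventually.and ?_ (hcont.eventually_mem (by rwa [hLP, mul_zero]))
      simp only [isUnit_iff_ne_zero] at hKP ⊢
      exact hK.matrix_det.continuousAt.eventually_ne hKP
    rw [mem_nhds_subtype]
    refine ⟨Quotient.mk bcSetoid '' {Q | IsUnit (K Q).det ∧ (K Q)⁻¹ * L Q ∈ U},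
      isOpenQuotientMap_mk.isOpenMap.image_mem_nhds hmem, ?_⟩
    rintro ⟨y, hy⟩ ⟨Q, ⟨hQ1, hQ2⟩, hQy⟩
    simp only at hQy
    subst hQy
    obtain ⟨H, h1, h2⟩ := hchart Q hy hQ1
    have h3 : f H = ⟨⟦Q⟧, hy⟩ := Subtype.ext h2
    rw [← h3]
    exact hUW (show H.1 ∈ U from h1 ▸ hQ2)

end DiscreteSL

theorem theorem3p5 (N : ℕ) (hN : 2 ≤ N) :
    (∀ (ω : SLE N) (bc : BC) (lam : ℂ), IsEigenvalueOfMult ω bc lam 1 →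
      ∃ (M : Set (SLE N × BC)) (Λ : SLE N × BC → ℂ),
        IsOpen M ∧ IsConnected M ∧ (ω, bc) ∈ M ∧ ContinuousOn Λ M ∧
        Λ (ω, bc) = lam ∧
        ∀ p ∈ M, IsEigenvalueOfMult p.1 p.2 (Λ p) 1) ∧
    (∀ (ω : SLE.realPos N) (bc : selfAdjointBC) (lam : ℂ),
      IsEigenvalueOfMult (ω : SLE N) (bc : BC) lam 2 →
      ∃ l : ℝ, lam = (l : ℂ) ∧
        ∀ ε : ℝ, 0 < ε →
          (∀ μ : ℝ, μ ∈ Set.Icc (l - ε) (l + ε) → IsEigenvalue (ω : SLE N) (bc : BC) (μ : ℂ) → μ = l) →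
          ∃ (F : Set (SLE.realPos N × selfAdjointBC)) (Λ₁ Λ₂ : SLE.realPos N × selfAdjointBC → ℝ),
            IsOpen F ∧ IsConnected F ∧ (ω, bc) ∈ F ∧ ContinuousOn Λ₁ F ∧ ContinuousOn Λ₂ F ∧
            Λ₁ (ω, bc) = l ∧ Λ₂ (ω, bc) = l ∧
            (∀ p ∈ F, l - ε < Λ₁ p ∧ Λ₁ p ≤ Λ₂ p ∧ Λ₂ p < l + ε) ∧
            ∀ p ∈ F, IsEigenvalue (p.1 : SLE N) (p.2 : BC) (Λ₁ p : ℂ) ∧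
              IsEigenvalue (p.1 : SLE N) (p.2 : BC) (Λ₂ p : ℂ)) := by
  obtain ⟨d, hd⟩ := exists_continuousCoeff_charPoly (N := N)
  constructor
  · intro ω bc lam hlam
    obtain ⟨P, rfl⟩ := Quotient.exists_rep bc
    have hπ : IsOpenQuotientMap (Prod.map id (Quotient.mk bcSetoid) :
        SLE N × BCMatrix → SLE N × BC) := IsOpenQuotientMap.id.prodMap isOpenQuotientMap_mk
    obtain ⟨M, Λ, h1, h2, h3, h4, h5, h6⟩ := exists_simple_root_branch hπ hd (by
      rintro ⟨σ, Q⟩ ⟨σ', Q'⟩ h z hz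
      obtain ⟨rfl, h'⟩ := Prod.mk.inj h
      rw [← isEigenvalue_mk_iff] at hz ⊢
      exact h' ▸ hz) (ω, P) lam hlam.2
    refine ⟨M, Λ, h1, h2, h3, h4, h5, fun p hp => ?_⟩
    obtain ⟨⟨σ, Q⟩, rfl, h⟩ := h6 p hp
    refine ⟨(isEigenvalue_mk_iff σ Q _).2 ?_, h⟩
    exact (rootMultiplicity_pos'.1 (h.symm ▸ one_pos)).2
  · intro ω bc lam hlam
    have him : lam.im = 0 := im_eq_zero_of_isEigenvalue hN ω.2 bc.2 hlam.1
    have hre : lam = (lam.re : ℂ) := Complex.ext rfl him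
    refine ⟨lam.re, hre, fun ε hε hiso => ?_⟩
    obtain ⟨bc, hbc⟩ := bc
    obtain ⟨P, rfl⟩ := Quotient.exists_rep bc
    -- Restricting an open quotient map to the full preimage of a subspace keeps it open, so the
    -- subspace topology on self-adjoint conditions is the right one downstairs.
    have hπ : IsOpenQuotientMap (Prod.map id
        (selfAdjointBC.restrictPreimage (Quotient.mk bcSetoid)) :
        SLE.realPos N × (Quotient.mk bcSetoid ⁻¹' selfAdjointBC) →
          SLE.realPos N × selfAdjointBC) :=
      IsOpenQuotientMap.id.prodMap (isOpenQuotientMap_mk.restrictPreimage _)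
    have hG : ContinuousCoeff (fun t : SLE.realPos N × (Quotient.mk bcSetoid ⁻¹' selfAdjointBC) =>
        charPoly t.1.1 t.2.1) d :=
      ⟨fun t => hd.1 (t.1.1, t.2.1), fun i => (hd.2 i).comp
        (g := fun t => (charPoly t.1 t.2).coeff i) (f := fun t :
          SLE.realPos N × (Quotient.mk bcSetoid ⁻¹' selfAdjointBC) => (t.1.1, t.2.1))
        (by fun_prop)⟩
    obtain ⟨F, Λ₁, Λ₂, h1, h2, h3, h4, h5, h6, h7, h8, h9⟩ :=
      exists_double_root_branches hπ hG (by
        rintro ⟨σ, Q⟩ ⟨σ', Q'⟩ h z hz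
        obtain ⟨rfl, h'⟩ := Prod.mk.inj h
        have h'' : (⟦Q.1⟧ : BC) = ⟦Q'.1⟧ := congrArg Subtype.val h'
        simp only [← isEigenvalue_mk_iff] at hz ⊢
        exact h'' ▸ hz)
        (fun t z hz => im_eq_zero_of_isEigenvalue (bc := ⟦t.2.1⟧) hN t.1.2 t.2.2
          ((isEigenvalue_mk_iff _ _ _).2 hz))
        (ω, ⟨P, hbc⟩) lam.re (by rw [← hre]; exact hlam.2) hε
        (fun μ hμ hr => hiso μ hμ ((isEigenvalue_mk_iff _ _ _).2 hr))
    refine ⟨F, Λ₁, Λ₂, h1, h2, h3, h4, h5, h6, h7, h8, fun p hp => ?_⟩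
    obtain ⟨t, rfl, hr1, hr2⟩ := h9 p hp
    exact ⟨(isEigenvalue_mk_iff t.1.1 t.2.1 _).2 hr1, (isEigenvalue_mk_iff t.1.1 t.2.1 _).2 hr2⟩
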